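/- Let $Q=(Q(i,j))_{i,j\in[n]}$ be the generator of an irreducible continuous-time Markov chain on $[n]=\{1,\dots,n\}$, reversible with respect to its invariant probability distribution $\pi$, and let $(X_t)_{t\ge 0}$ and $(Y_t)_{t\ge 0}$ be two independent copies of the chain, with càdlàg paths; $\mathbb{E}_{x}$ and $\mathbb{E}_{x,y}$ denote expectation when $X_0=x$, respectively $(X_0,Y_0)=(x,y)$. For $s\in[n]$ let $T_s=\inf\{t\ge 0: X_t=s\}$ and $\tau_{\rm meet}=\inf\{t\ge 0: X_t=Y_t\}$, and set $$t_{\rm hit}(s)=\max_{x\in[n]}\mathbb{E}_x(T_s),\qquad t_{\rm meet}=\max_{x,y\in[n]}\mathbb{E}_{x,y}(\tau_{\rm meet}),\qquad t_{\rm mix}=\min\Big\{t\ge 0:\ \tfrac12\max_{x\in[n]}\sum_{j\in[n]}\big|p^{(t)}_{x,j}-\pi(j)\big|\le \tfrac14\Big\},$$ where $p^{(t)}=e^{tQ}$. Then for every state $s\in[n]$: 1. $\displaystyle t_{\rm meet}\le \frac{189\,t_{\rm hit}(s)}{\pi(s)}$; 2. $t_{\rm mix}\le 16\,t_{\rm hit}(s)$;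 3. for all $x,y\in[n]$ there is a strong stationary time $\mathcal S$ for the pair $(X_t,Y_t)_{t\ge0}$ started at $(x,y)$ with $\mathbb{E}_{x,y}(\mathcal S)\le 188\,t_{\rm hit}(s)$. That is, $\mathcal S$ is an almost surely finite randomized stopping time (the event $\{\mathcal S\le t\}$ is determined by $(X_u,Y_u)_{u\le t}$ and additional randomness independent of $(X,Y)$) such that $(X_{t+\mathcal S},Y_{t+\mathcal S})$ has law $\pi\otimes\pi$ for every $t\ge 0$, and the process $(X_{t+\mathcal S},Y_{t+\mathcal S})_{t\ge 0}$ is independent of $\mathcal S$. -/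

import Mathlib

open MeasureTheory ProbabilityTheory Filter Topology
open scoped NNReal ENNReal

noncomputable section

namespace CTChain

section Generator

variable {V : Type*} [Fintype V] [DecidableEq V]

/-- `Q` is the (conservative) generator of a continuous-time Markov chain on the finite set `V`. -/
structure IsGenerator (Q : Matrix V V ℝ) : Prop where
  nonneg : ∀ i j, i ≠ j → 0 ≤ Q i j
  row_sum : ∀ i, ∑ j, Q i j = 0

/-- Any two states are joined by a sequence of transitions of positive rate. -/
def IsIrreducible (Q : Matrix V V ℝ) : Prop :=
  ∀ i j, Relation.ReflTransGen (fun a b => a ≠ b ∧ 0 < Q a b) i j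

/-- `π` is an invariant probability distribution of the chain with generator `Q`. -/
structure IsInvariant (Q : Matrix V V ℝ) (π : V → ℝ) : Prop where
  nonneg : ∀ i, 0 ≤ π i
  sum_eq_one : ∑ i, π i = 1
  invariant : ∀ j, ∑ i, π i * Q i j = 0

/-- Detailed balance of `Q` with respect to `π`. -/
def IsReversible (Q : Matrix V V ℝ) (π : V → ℝ) : Prop :=
  ∀ i j, π i * Q i j = π j * Q j i

/-- The transition probabilities `p^{(t)}_{i,j}`: the entries of the matrix `exp (t Q)`. -/
def transition (Q : Matrix V V ℝ) (t : ℝ≥0) : Matrix V V ℝ :=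
  NormedSpace.exp ((t : ℝ) • Q)

/-- `d(t) = (1/2) max_x ‖p^{(t)}_{x,·} - π‖₁`. -/
def statDist (Q : Matrix V V ℝ) (π : V → ℝ) (t : ℝ≥0) : ℝ :=
  ⨆ x : V, (1 / 2 : ℝ) * ∑ j, |transition Q t x j - π j|

/-- The mixing time: the least `t ≥ 0` with `d(t) ≤ 1/4`. -/
def mixingTime (Q : Matrix V V ℝ) (π : V → ℝ) : ℝ≥0∞ :=
  ⨅ (t : ℝ≥0) (_ : statDist Q π t ≤ 1 / 4), (t : ℝ≥0∞)

end Generator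

section Paths

variable {V : Type*} {Ω : Type*}

/-- The σ-algebra generated by `X u`, `u ≤ t`. -/
@[reducible] def past (X : ℝ≥0 → Ω → V) (t : ℝ≥0) : MeasurableSpace Ω :=
  ⨆ (u : ℝ≥0) (_ : u ≤ t), MeasurableSpace.comap (X u) ⊤

/-- Under `P`, the process `X` is a continuous-time Markov chain with generator `Q` started at
`x`, with càdlàg paths. The field `markov` is the identity
`P (X (t + h) = v | X u, u ≤ t) = p^{(h)}_{X t, v}`, integrated over the events `A` of the past. -/
structure IsMarkovChain [Fintype V] [DecidableEq V] [MeasurableSpace Ω]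
    (Q : Matrix V V ℝ) (P : Measure Ω) (X : ℝ≥0 → Ω → V) (x : V) : Prop where
  isProbabilityMeasure : IsProbabilityMeasure P
  measurableSet_eq : ∀ t v, MeasurableSet {ω | X t ω = v}
  right_continuous : ∀ ω t, ∀ᶠ u in 𝓝[>] t, X u ω = X t ω
  left_limit : ∀ ω t, ∃ v, ∀ᶠ u in 𝓝[<] t, X u ω = v
  start : ∀ᵐ ω ∂P, X 0 ω = x
  markov : ∀ (t h : ℝ≥0) (v : V) (A : Set Ω), MeasurableSet[past X t] A →
    P (A ∩ {ω | X (t + h) ω = v}) =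
      ∑ u, P (A ∩ {ω | X t ω = u}) * ENNReal.ofReal (transition Q h u v)

/-- `T_s = inf {t ≥ 0 : X t = s}`, with `inf ∅ = ∞`. -/
def hitTime (X : ℝ≥0 → Ω → V) (s : V) (ω : Ω) : ℝ≥0∞ :=
  ⨅ (t : ℝ≥0) (_ : X t ω = s), (t : ℝ≥0∞)

/-- `τ_meet = inf {t ≥ 0 : X t = Y t}`, with `inf ∅ = ∞`. -/
def meetTime (X Y : ℝ≥0 → Ω → V) (ω : Ω) : ℝ≥0∞ :=
  ⨅ (t : ℝ≥0) (_ : X t ω = Y t ω), (t : ℝ≥0∞)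

variable [MeasurableSpace Ω]

/-- `t_hit(s) = max_x E_x T_s`, where `P x` is the law under which the chain starts at `x`. -/
def expHit (P : V → Measure Ω) (X : ℝ≥0 → Ω → V) (s : V) : ℝ≥0∞ :=
  ⨆ x, ∫⁻ ω, hitTime X s ω ∂(P x)

/-- `t_meet = max_{x,y} E_{x,y} τ_meet` for two independent copies of the chain, realised as the
two coordinate processes on `Ω × Ω` under `P x ⊗ P y`. -/
def expMeet (P : V → Measure Ω) (X : ℝ≥0 → Ω → V) : ℝ≥0∞ :=
  ⨆ (x) (y), ∫⁻ ω, meetTime (fun t (ω : Ω × Ω) => X t ω.1) (fun t ω => X t ω.2) ω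
    ∂((P x).prod (P y))

/-- `S` is a strong stationary time for the pair `(X_t, Y_t)` of independent copies started at
`(x, y)`, realised on `Ω × Ω × U` under `P x ⊗ P y ⊗ ν`; the factor `(U, ν)` carries the
additional randomness that `S` may use. -/
structure IsStrongStationaryTime {U : Type*} [mU : MeasurableSpace U] [MeasurableSpace V]
    (π : V → ℝ) (P : V → Measure Ω) (X : ℝ≥0 → Ω → V) (x y : V) (ν : Measure U)
    (S : Ω × Ω × U → ℝ≥0∞) : Prop where
  /-- `S` is a stopping time for the joint past of the two copies, enlarged by the independent
  randomness. -/
  stopping : ∀ t : ℝ≥0,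
    MeasurableSet[(past X t).prod ((past X t).prod mU)] {ω | S ω ≤ t}
  finite : ∀ᵐ ω ∂((P x).prod ((P y).prod ν)), S ω ≠ ∞
  /-- `(X_{t+S}, Y_{t+S})` has law `π ⊗ π`. -/
  stationary : ∀ (t : ℝ≥0) (i j : V),
    ((P x).prod ((P y).prod ν))
      {ω | X (t + (S ω).toNNReal) ω.1 = i ∧ X (t + (S ω).toNNReal) ω.2.1 = j} =
      ENNReal.ofReal (π i * π j)
  /-- The process `(X_{t+S}, Y_{t+S})_{t ≥ 0}` is independent of `S`. -/
  indep : IndepFun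
    (fun ω (t : ℝ≥0) => (X (t + (S ω).toNNReal) ω.1, X (t + (S ω).toNNReal) ω.2.1)) S
    ((P x).prod ((P y).prod ν))

end Paths

end CTChain

end

/-!
Everything is reduced to visits of the single state `s`. Write `H` for the maximal expected hitting
time of `s`. Within time `4 H` the chain visits `s` with probability at least `3 / 4` from every
start, by Markov's inequality; since paths are right-continuous, on a fine enough grid of mesh `δ`
with `l δ = 4 H` the visit is seen with probability at least `5 / 7` (`exists_avoid_le`). From there
on the argument is about the finite matrix `exp (δ Q)`, through the recursion `avoid` for the
probability of not having visited `s`.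

By reversibility and the Cauchy–Schwarz inequality, the return probability `p^{(t)}_{s,s}` is at
least `π s` for every `t` (`le_transition_self`). A first-passage argument then gives
`p^{(t)}_{x,s} ≥ (5 / 7) π s` for `t ≥ 4 H`, and, applied once more to the reversed chain,
`p^{(8 H)}_{x,y} ≥ (5 / 7) ^ 2 π y ≥ π y / 2` for all `x` and `y`
(`sq_mul_le_transition_of_avoid`). The three assertions follow.

* Mixing: two such periods give `p^{(16 H)}_{x,y} ≥ 3 π y / 4`, hence total variation distance at
  most `1 / 4` (`statDist_le_of_half_le`).
* Strong stationary time: for the pair the minorization holds at time `8 H` with constant `1 / 4`.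
  Observing the pair at multiples of `8 H` and accepting a step from `u` to `v` with probability
  `π⊗π (v) / (4 K (u, v))`, every step is accepted with probability `1 / 4` independently of the
  past, and the state at an acceptance has law `π⊗π`; the first acceptance has mean `32 H`
  (`IsMarkovWith.exists_strongStationary`). Independence of the future holds because the law of a
  restarted Markov process is determined by its initial law (`IsMarkovWith.measure_inter_path_eq`).
* Meeting: a second-moment bound on the number of grid times before `12 H` at which both copies are
  at `s` shows that this happens with probability at least `(5 / 7) ^ 3 π s / 2`
  (`le_one_sub_avoid_kronecker`), and a geometric number of attempts suffices
  (`IsMarkovWith.lintegral_le_of_avoid_le`).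

The constants obtained are smaller than the ones claimed, except for the mixing time. If `H = 0`
there is only one state; if `H = ∞` only the existence of a strong stationary time is at stake, and
it follows from the positivity of `p^{(1)}` (`transition_pos`).
-/

namespace CTChain

/-! ### Avoidance probabilities of a finite stochastic matrix -/

section Avoid

variable {V : Type*} [Fintype V] [DecidableEq V]

/-- The probability that the discrete-time chain with transition matrix `K`, started at `x`, is
away from `s` at all of the times `0, …, m - 1`. -/
def avoid (K : Matrix V V ℝ) (s : V) : ℕ → V → ℝ
  | 0, _ => 1
  | m + 1, x => if x = s then 0 else ∑ y, K x y * avoid K s m y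

variable {K : Matrix V V ℝ} {s : V}

lemma avoid_nonneg (hK : ∀ x y, 0 ≤ K x y) (m : ℕ) (x : V) : 0 ≤ avoid K s m x := by
  induction m generalizing x with
  | zero => simp [avoid]
  | succ m ih =>
    rw [avoid]
    split_ifs
    · exact le_rfl
    · exact Finset.sum_nonneg fun y _ => mul_nonneg (hK x y) (ih y)

lemma avoid_le_one (hK : ∀ x y, 0 ≤ K x y) (h1 : ∀ x, ∑ y, K x y = 1) (m : ℕ) (x : V) :
    avoid K s m x ≤ 1 := by
  induction m generalizing x with
  | zero => simp [avoid]
  | succ m ih =>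
    rw [avoid]
    split_ifs
    · exact zero_le_one
    · exact (Finset.sum_le_sum fun y _ => mul_le_of_le_one_right (hK x y) (ih y)).trans (h1 x).le

lemma one_sub_avoid_succ (h1 : ∀ x, ∑ y, K x y = 1) (m : ℕ) {x : V} (hx : x ≠ s) :
    1 - avoid K s (m + 1) x = ∑ y, K x y * (1 - avoid K s m y) := by
  simp only [avoid, if_neg hx, mul_sub, mul_one, Finset.sum_sub_distrib, h1]

/-- First-passage bound: a family `φ` that dominates its own evolution under `K` and is at least
`c` at `s` is at least `c` times the probability of having visited `s`. -/
lemma mul_one_sub_avoid_le (hK : ∀ x y, 0 ≤ K x y) (h1 : ∀ x, ∑ y, K x y = 1) {φ : ℕ → V → ℝ}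
    {c : ℝ} (h0 : ∀ x, 0 ≤ φ 0 x) (hs : ∀ k, c ≤ φ k s)
    (hφ : ∀ k x, ∑ y, K x y * φ k y ≤ φ (k + 1) x) (m : ℕ) (x : V) :
    c * (1 - avoid K s m x) ≤ φ m x := by
  induction m generalizing x with
  | zero => simpa [avoid] using h0 x
  | succ m ih =>
    by_cases hx : x = s
    · subst hx
      simpa [avoid] using hs (m + 1)
    · rw [one_sub_avoid_succ h1 m hx, Finset.mul_sum]
      refine le_trans (Finset.sum_le_sum fun y _ => ?_) (hφ m x)
      rw [mul_left_comm]
      exact mul_le_mul_of_nonneg_left (ih y) (hK x y)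

/-- The expected number of visits to `s` before time `m` is at most the probability of a visit
times the expected number of visits for the chain started at `s`. -/
lemma sum_pow_le_one_sub_avoid_mul (hK : ∀ x y, 0 ≤ K x y) (h1 : ∀ x, ∑ y, K x y = 1)
    (hpow : ∀ k, 0 ≤ (K ^ k) s s) (m : ℕ) (x : V) :
    ∑ k ∈ Finset.range m, (K ^ k) x s ≤
      (1 - avoid K s m x) * ∑ k ∈ Finset.range m, (K ^ k) s s := by
  induction m generalizing x with
  | zero => simp
  | succ m ih =>
    by_cases hx : x = s
    · subst hx
      simp [avoid]
    · have hstep : ∑ k ∈ Finset.range (m + 1), (K ^ k) x s =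
          ∑ y, K x y * ∑ k ∈ Finset.range m, (K ^ k) y s := by
        rw [Finset.sum_range_succ']
        simp only [pow_zero, Matrix.one_apply_ne hx, add_zero, pow_succ', Matrix.mul_apply,
          Finset.mul_sum]
        rw [Finset.sum_comm]
      rw [hstep, one_sub_avoid_succ h1 m hx, Finset.sum_mul]
      refine Finset.sum_le_sum fun y _ => ?_
      rw [mul_assoc]
      refine mul_le_mul_of_nonneg_left ((ih y).trans ?_) (hK x y)
      refine mul_le_mul_of_nonneg_left ?_ (sub_nonneg.2 (avoid_le_one hK h1 m y))
      rw [Finset.sum_range_succ]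
      linarith [hpow m]

end Avoid

/-! ### The transition matrices of a reversible generator -/

section Transition

/-- Detailed balance propagates positivity of `π` along the edges of the transition graph. -/
lemma IsInvariant.pos {V : Type*} [Fintype V] {Q : Matrix V V ℝ} {π : V → ℝ}
    (hirr : IsIrreducible Q) (hπ : IsInvariant Q π)
    (hrev : IsReversible Q π) (i : V) : 0 < π i := by
  obtain ⟨j, hj⟩ : ∃ j, 0 < π j := by
    by_contra! h
    have := Finset.sum_nonpos fun i (_ : i ∈ Finset.univ) => h i
    rw [hπ.sum_eq_one] at this
    linarith
  induction hirr j i with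
  | refl => exact hj
  | @tail a b _ hab ih =>
    have h : 0 < π b * Q b a := hrev a b ▸ mul_pos ih hab.2
    exact (hπ.nonneg b).lt_of_ne fun h0 => by simp [← h0] at h

variable {V : Type*} [Fintype V] [DecidableEq V] {Q : Matrix V V ℝ} {π : V → ℝ}

lemma transition_zero (Q : Matrix V V ℝ) : transition Q 0 = 1 := by
  simp [transition]

lemma transition_add (Q : Matrix V V ℝ) (t h : ℝ≥0) :
    transition Q (t + h) = transition Q t * transition Q h := by
  unfold transition
  rw [NNReal.coe_add, add_smul]
  exact Matrix.exp_add_of_commute _ _ (((Commute.refl Q).smul_left _).smul_right _)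

lemma transition_nsmul (Q : Matrix V V ℝ) (k : ℕ) (t : ℝ≥0) :
    transition Q (k * t) = transition Q t ^ k := by
  induction k with
  | zero => simp [transition_zero]
  | succ k ih => rw [Nat.cast_succ, add_mul, one_mul, transition_add, ih, pow_succ]

open scoped Matrix.Norms.Operator in
lemma semiconjBy_transition {A B C : Matrix V V ℝ} (h : SemiconjBy A B C) (t : ℝ≥0) :
    SemiconjBy A (transition B t) (transition C t) := by
  unfold transition
  refine SemiconjBy.exp_right ?_
  rw [SemiconjBy, Matrix.mul_smul, Matrix.smul_mul, h.eq]

lemma IsGenerator.sum_transition (hQ : IsGenerator Q) (t : ℝ≥0) (x : V) :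
    ∑ y, transition Q t x y = 1 := by
  -- `Q J = J 0` for the all-ones matrix `J`, hence `exp (t Q) J = J`.
  have h : SemiconjBy (Matrix.of fun _ _ : V => (1 : ℝ)) 0 Q := by
    ext i j
    simp [Matrix.mul_apply, hQ.row_sum]
  have h2 := congrFun (congrFun (semiconjBy_transition h t).eq x) x
  have h0 : transition (0 : Matrix V V ℝ) t = 1 := by simp [transition]
  rw [h0, mul_one] at h2
  simpa [Matrix.mul_apply] using h2.symm

/-- Detailed balance passes from the generator to the transition probabilities. -/
lemma IsReversible.transition_comm (hrev : IsReversible Q π) (t : ℝ≥0) (x y : V) :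
    π x * transition Q t x y = π y * transition Q t y x := by
  have h : SemiconjBy (Matrix.diagonal π) Q Q.transpose := by
    ext i j
    simp only [Matrix.diagonal_mul, Matrix.mul_diagonal, Matrix.transpose_apply]
    rw [hrev i j, mul_comm]
  have hT : transition Q.transpose t = (transition Q t).transpose := by
    rw [transition, transition, ← Matrix.transpose_smul, Matrix.exp_transpose]
  have h2 := congrFun (congrFun (semiconjBy_transition h t).eq x) y
  rw [hT, Matrix.diagonal_mul, Matrix.mul_diagonal, Matrix.transpose_apply] at h2
  rw [h2, mul_comm]

lemma sum_invariant_mul_transition (hQ : IsGenerator Q) (hrev : IsReversible Q π) (t : ℝ≥0)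
    (y : V) : ∑ x, π x * transition Q t x y = π y := by
  simp_rw [hrev.transition_comm t _ y, ← Finset.mul_sum, hQ.sum_transition, mul_one]

/-- For a reversible chain the return probability never drops below its limit: split `t` in two
halves and apply the Cauchy–Schwarz inequality. -/
lemma le_transition_self (hQ : IsGenerator Q) (hπ : IsInvariant Q π) (hrev : IsReversible Q π)
    (hpos : ∀ i, 0 < π i) (t : ℝ≥0) (s : V) : π s ≤ transition Q t s s := by
  have hsum : transition Q t s s =
      π s * ∑ j, transition Q (t / 2) s j ^ 2 / π j := by
    conv_lhs => rw [← add_halves t, transition_add, Matrix.mul_apply]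
    rw [Finset.mul_sum]
    refine Finset.sum_congr rfl fun j _ => ?_
    have h := hrev.transition_comm (t / 2) s j
    field_simp [(hpos j).ne']
    linear_combination -transition Q (t / 2) s j * h
  have hcs := Finset.sq_sum_div_le_sum_sq_div Finset.univ (fun j => transition Q (t / 2) s j)
    (fun j _ => hpos j)
  rw [hQ.sum_transition, hπ.sum_eq_one] at hcs
  rw [hsum]
  have := hpos s
  nlinarith

open scoped Matrix.Norms.Operator in
/-- Along an edge of the transition graph, arbitrarily small times have positive transition
probability, because `exp (ε Q) = 1 + ε Q + o(ε)`. -/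
lemma exists_transition_pos {i j : V} (hij : i ≠ j) (hq : 0 < Q i j) {t : ℝ≥0} (ht : 0 < t) :
    ∃ ε : ℝ≥0, ε ≤ t ∧ 0 < transition Q ε i j := by
  let E : Matrix V V ℝ →L[ℝ] ℝ := (Matrix.entryLinearMap ℝ ℝ i j).toContinuousLinearMap
  have hd : HasDerivAt (fun u : ℝ => E (NormedSpace.exp (u • Q))) (Q i j) 0 := by
    have h := E.hasFDerivAt.comp_hasDerivAt (0 : ℝ) (hasDerivAt_exp_smul_const (𝕂 := ℝ) Q 0)
    rw [zero_smul, NormedSpace.exp_zero, one_mul] at h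
    exact h
  have hlim : Tendsto (slope (fun u : ℝ => E (NormedSpace.exp (u • Q))) 0) (𝓝[>] 0)
      (𝓝 (Q i j)) :=
    (hasDerivAt_iff_tendsto_slope.1 hd).mono_left (nhdsWithin_mono 0 fun u hu => ne_of_gt hu)
  obtain ⟨u, hu, hu0, hut⟩ := ((hlim.eventually (lt_mem_nhds hq)).and
    (Ioo_mem_nhdsGT (NNReal.coe_pos.2 ht))).exists
  refine ⟨⟨u, hu0.le⟩, hut.le, ?_⟩
  have h0 : E (NormedSpace.exp ((0 : ℝ) • Q)) = 0 := by simp [E, Matrix.one_apply_ne hij]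
  rw [slope_def_field, sub_zero, h0, sub_zero] at hu
  exact (div_pos_iff_of_pos_right hu0).1 hu

/-- All transition probabilities of an irreducible chain are positive at positive times. -/
lemma transition_pos (hQ : IsGenerator Q) (hirr : IsIrreducible Q) (hπ : IsInvariant Q π)
    (hrev : IsReversible Q π) (hnn : ∀ t x y, 0 ≤ transition Q t x y) (i j : V) {t : ℝ≥0}
    (ht : 0 < t) : 0 < transition Q t i j := by
  have hpos := hπ.pos hirr hrev
  induction hirr i j generalizing t with
  | refl => exact (hpos i).trans_le (le_transition_self hQ hπ hrev hpos t i)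
  | @tail a b _ hab ih =>
    obtain ⟨ε, hε, hpε⟩ := exists_transition_pos hab.1 hab.2 (half_pos ht)
    have hlt : 0 < t - ε := tsub_pos_of_lt (hε.trans_lt (half_lt_self ht))
    rw [← tsub_add_cancel_of_le (hε.trans (half_le_self zero_le)), transition_add,
      Matrix.mul_apply]
    exact (mul_pos (ih hlt) hpε).trans_le (Finset.single_le_sum
      (f := fun z => transition Q (t - ε) i z * transition Q ε z b)
      (fun z _ => mul_nonneg (hnn _ _ _) (hnn _ _ _)) (Finset.mem_univ a))

end Transition

/-! ### Bounds for reversible chains from avoidance probabilities -/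

section Reversible

variable {V : Type*} [Fintype V] [DecidableEq V] {Q : Matrix V V ℝ} {π : V → ℝ}

/-- After time `l δ` the probability of being at `s` is comparable to `π s`, from every start. -/
lemma mul_le_transition_of_avoid (hQ : IsGenerator Q) (hπ : IsInvariant Q π)
    (hrev : IsReversible Q π) (hpos : ∀ i, 0 < π i) (hnn : ∀ t x y, 0 ≤ transition Q t x y)
    {δ : ℝ≥0} {l : ℕ} {s : V} {c : ℝ} (hc : ∀ x, c ≤ 1 - avoid (transition Q δ) s l x)
    {u : ℝ≥0} (hu : l * δ ≤ u) (x : V) : c * π s ≤ transition Q u x s := by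
  have h := mul_one_sub_avoid_le (K := transition Q δ) (s := s) (c := π s)
    (φ := fun k y => transition Q (k * δ + (u - l * δ)) y s)
    (hnn δ) (hQ.sum_transition δ) (fun y => hnn _ _ _)
    (fun k => le_transition_self hQ hπ hrev hpos _ s)
    (fun k y => by
      rw [Nat.cast_succ, add_mul, one_mul, add_comm _ δ, add_assoc, transition_add Q δ,
        Matrix.mul_apply]) l x
  rw [add_tsub_cancel_of_le hu] at h
  nlinarith [hc x, hpos s]

/-- The transition probabilities at time `2 l δ` dominate a multiple of `π`: both the chain started
at `x` and, by reversibility, the chain started at `y` have probably visited `s` by time `l δ`, and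
return probabilities to `s` are at least `π s`. -/
lemma sq_mul_le_transition_of_avoid (hQ : IsGenerator Q) (hπ : IsInvariant Q π)
    (hrev : IsReversible Q π) (hpos : ∀ i, 0 < π i) (hnn : ∀ t x y, 0 ≤ transition Q t x y)
    {δ : ℝ≥0} {l : ℕ} {s : V} {c : ℝ} (hc0 : 0 ≤ c)
    (hc : ∀ x, c ≤ 1 - avoid (transition Q δ) s l x) (x y : V) :
    c ^ 2 * π y ≤ transition Q (2 * (l * δ)) x y := by
  have hsy : ∀ u : ℝ≥0, l * δ ≤ u → c * π y ≤ transition Q u s y := fun u hu => by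
    have h1 := mul_le_transition_of_avoid hQ hπ hrev hpos hnn hc hu y
    have h2 := hrev.transition_comm u s y
    have h3 : π s * (c * π y) ≤ π s * transition Q u s y := by
      rw [h2]
      nlinarith [hpos y]
    exact le_of_mul_le_mul_left h3 (hpos s)
  have h := mul_one_sub_avoid_le (K := transition Q δ) (s := s) (c := c * π y)
    (φ := fun k z => transition Q (k * δ + l * δ) z y)
    (hnn δ) (hQ.sum_transition δ) (fun z => hnn _ _ _)
    (fun k => hsy _ le_add_self)
    (fun k z => by
      rw [Nat.cast_succ, add_mul (k : ℝ≥0), one_mul, add_comm _ δ, add_assoc, transition_add Q δ,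
        Matrix.mul_apply]) l x
  rw [← two_mul] at h
  refine le_trans ?_ h
  have := mul_le_mul_of_nonneg_left (hc x) (mul_nonneg hc0 (hpos y).le)
  linarith

lemma mixingTime_le {t : ℝ≥0} (h : statDist Q π t ≤ 1 / 4) : mixingTime Q π ≤ t :=
  iInf₂_le t h

/-- A minorization by half of `π` at time `t` gives total variation distance at most `1/4` at time
`2 t`. -/
lemma statDist_le_of_half_le [Nonempty V] (hQ : IsGenerator Q) (hπ : IsInvariant Q π)
    (hrev : IsReversible Q π) {t : ℝ≥0} (h : ∀ x y, 1 / 2 * π y ≤ transition Q t x y) :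
    statDist Q π (t + t) ≤ 1 / 4 := by
  refine ciSup_le fun x => ?_
  have h2 : ∀ y, 3 / 4 * π y ≤ transition Q (t + t) x y := fun y => by
    rw [transition_add, Matrix.mul_apply]
    have h3 : ∑ z, (transition Q t x z - 1 / 2 * π z) * (1 / 2 * π y) ≤
        ∑ z, (transition Q t x z - 1 / 2 * π z) * transition Q t z y :=
      Finset.sum_le_sum fun z _ => mul_le_mul_of_nonneg_left (h z y) (sub_nonneg.2 (h x z))
    have h4 := sum_invariant_mul_transition hQ hrev t y
    simp only [sub_mul, Finset.sum_sub_distrib, ← Finset.sum_mul, hQ.sum_transition,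
      ← Finset.mul_sum, hπ.sum_eq_one, mul_assoc, h4] at h3
    linarith
  have h3 : ∀ y, |transition Q (t + t) x y - π y| ≤
      transition Q (t + t) x y - 1 / 2 * π y := fun y => by
    rw [abs_le]
    constructor <;> linarith [h2 y, hπ.nonneg y]
  have h4 := Finset.sum_le_sum fun y (_ : y ∈ Finset.univ) => h3 y
  rw [Finset.sum_sub_distrib, hQ.sum_transition, ← Finset.mul_sum, hπ.sum_eq_one] at h4
  linarith

open scoped Kronecker in
/-- Second-moment bound for two independent copies: from any pair of starting states they are
simultaneously at `s` at one of the first `3 l` multiples of `δ` with probability at least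
`c ^ 3 * π s / 2`. -/
lemma le_one_sub_avoid_kronecker (hQ : IsGenerator Q) (hπ : IsInvariant Q π)
    (hrev : IsReversible Q π) (hpos : ∀ i, 0 < π i) (hnn : ∀ t x y, 0 ≤ transition Q t x y)
    {δ : ℝ≥0} {l : ℕ} (hl : 0 < l) {s : V} {c : ℝ} (hc0 : 0 ≤ c)
    (hc : ∀ x, c ≤ 1 - avoid (transition Q δ) s l x) (w : V × V) :
    c ^ 3 * π s / 2 ≤
      1 - avoid (transition Q δ ⊗ₖ transition Q δ) (s, s) (3 * l) w := by
  set M := transition Q δ with hM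
  have hle1 : ∀ t x y, transition Q t x y ≤ 1 := fun t x y => by
    rw [← hQ.sum_transition t x]
    exact Finset.single_le_sum (fun z _ => hnn t x z) (Finset.mem_univ y)
  have hMk : ∀ k : ℕ, M ^ k = transition Q (k * δ) := fun k => (transition_nsmul Q k δ).symm
  have hpow : ∀ k : ℕ, (M ⊗ₖ M) ^ k = (M ^ k) ⊗ₖ (M ^ k) := fun k => by
    induction k with
    | zero => simp
    | succ k ih => rw [pow_succ, ih, ← Matrix.mul_kronecker_mul, ← pow_succ]
  set G := ∑ k ∈ Finset.range (3 * l), (M ^ k) s s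
  have hG0 : 0 ≤ G := Finset.sum_nonneg fun k _ => by rw [hMk]; exact hnn _ _ _
  -- The Green function at `s` up to time `3 l`: average over `π` the number of visits up to `4 l`.
  have hG : c * G ≤ 4 * l * π s := by
    have h1 : ∀ x, c * G ≤ ∑ k ∈ Finset.range (3 * l + l), (M ^ k) x s := fun x => by
      have h := mul_one_sub_avoid_le (K := M) (s := s) (c := G)
        (φ := fun j y => ∑ k ∈ Finset.range (3 * l + j), (M ^ k) y s) (hnn δ)
        (hQ.sum_transition δ)
        (fun y => Finset.sum_nonneg fun k _ => by rw [hMk]; exact hnn _ _ _)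
        (fun j => Finset.sum_le_sum_of_subset_of_nonneg
          (Finset.range_mono (Nat.le_add_right _ _))
          fun k _ _ => by rw [hMk]; exact hnn _ _ _)
        (fun j y => by
          rw [← add_assoc, Finset.sum_range_succ']
          simp only [pow_succ', Matrix.mul_apply, Finset.mul_sum, pow_zero]
          rw [Finset.sum_comm]
          exact le_add_of_nonneg_right (by rw [Matrix.one_apply]; split_ifs <;> simp)) l x
      nlinarith [hc x]
    have h2 := Finset.sum_le_sum fun x (_ : x ∈ Finset.univ) =>
      mul_le_mul_of_nonneg_left (h1 x) (hpos x).le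
    rw [← Finset.sum_mul, hπ.sum_eq_one, one_mul] at h2
    simp only [Finset.mul_sum, hMk] at h2
    rw [Finset.sum_comm] at h2
    simp only [sum_invariant_mul_transition hQ hrev, Finset.sum_const, Finset.card_range,
      nsmul_eq_mul] at h2
    push_cast at h2
    linarith
  -- The expected number of joint visits, counting only the times from `l` on.
  have hN : 2 * l * (c * π s) ^ 2 ≤
      ∑ k ∈ Finset.range (3 * l), ((M ⊗ₖ M) ^ k) w (s, s) := by
    have h1 : ∑ k ∈ Finset.Ico l (3 * l), (c * π s) ^ 2 ≤
        ∑ k ∈ Finset.Ico l (3 * l), ((M ⊗ₖ M) ^ k) w (s, s) :=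
      Finset.sum_le_sum fun k hk => by
        have h2 : ∀ x, c * π s ≤ (M ^ k) x s := fun x => by
          rw [hMk]
          exact mul_le_transition_of_avoid hQ hπ hrev hpos hnn hc
            (mul_le_mul_left (Nat.cast_le.2 (Finset.mem_Ico.1 hk).1) δ) x
        rw [hpow, Matrix.kroneckerMap_apply, sq]
        exact mul_le_mul (h2 _) (h2 _) (mul_nonneg hc0 (hpos s).le)
          ((mul_nonneg hc0 (hpos s).le).trans (h2 _))
    have hcard : 3 * l - l = 2 * l := by omega
    rw [Finset.sum_const, Nat.card_Ico, hcard, nsmul_eq_mul] at h1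
    push_cast at h1
    refine h1.trans (Finset.sum_le_sum_of_subset_of_nonneg (fun k hk => ?_) fun k _ _ => ?_)
    · exact Finset.mem_range.2 (Finset.mem_Ico.1 hk).2
    · rw [hpow, Matrix.kroneckerMap_apply, hMk]
      exact mul_nonneg (hnn _ _ _) (hnn _ _ _)
  have hK0 : ∀ x y, 0 ≤ (M ⊗ₖ M) x y := fun x y => mul_nonneg (hnn _ _ _) (hnn _ _ _)
  have hK1 : ∀ x, ∑ y, (M ⊗ₖ M) x y = 1 := fun x => by
    simp only [Fintype.sum_prod_type, Matrix.kroneckerMap_apply, ← Finset.mul_sum, hM,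
      hQ.sum_transition, mul_one]
  have hgreen := sum_pow_le_one_sub_avoid_mul hK0 hK1 (s := (s, s))
    (fun k => by
      rw [hpow, Matrix.kroneckerMap_apply, hMk]
      exact mul_nonneg (hnn _ _ _) (hnn _ _ _)) (3 * l) w
  have hGle : ∑ k ∈ Finset.range (3 * l), ((M ⊗ₖ M) ^ k) (s, s) (s, s) ≤ G :=
    Finset.sum_le_sum fun k _ => by
      rw [hpow, Matrix.kroneckerMap_apply, hMk]
      exact mul_le_of_le_one_left (hnn _ _ _) (hle1 _ _ _)
  have hr : 0 ≤ 1 - avoid (M ⊗ₖ M) (s, s) (3 * l) w :=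
    sub_nonneg.2 (avoid_le_one hK0 hK1 _ _)
  set r := 1 - avoid (M ⊗ₖ M) (s, s) (3 * l) w
  have h1 : 2 * l * (c * π s) ^ 2 ≤ r * G :=
    hN.trans (hgreen.trans (mul_le_mul_of_nonneg_left hGle hr))
  have h2 : c * (2 * l * (c * π s) ^ 2) ≤ r * (4 * l * π s) := by nlinarith
  have hl' : (0 : ℝ) < 4 * l * π s := by have := hpos s; positivity
  refine le_of_mul_le_mul_right (le_trans (le_of_eq ?_) h2) hl'
  ring

end Reversible

/-! ### Markov processes with respect to a filtration -/

section Markov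

variable {Ω W : Type*} [Fintype W]

/-- Under `μ`, the finite-state process `Z` is adapted to the filtration `F` and satisfies the
Markov property with respect to it, with transition matrices `K h`. The Markov property is
integrated over the events `A` of `F t`, and no semigroup property of `K` is required. -/
structure IsMarkovWith {m0 : MeasurableSpace Ω} (μ : Measure Ω) (F : ℝ≥0 → MeasurableSpace Ω)
    (Z : ℝ≥0 → Ω → W) (K : ℝ≥0 → Matrix W W ℝ) : Prop where
  le : ∀ t, F t ≤ m0
  mono : Monotone F
  adapted : ∀ t w, MeasurableSet[F t] {ω | Z t ω = w}
  markov : ∀ (t h : ℝ≥0) (v : W) (A : Set Ω), MeasurableSet[F t] A →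
    μ (A ∩ {ω | Z (t + h) ω = v}) =
      ∑ u, μ (A ∩ {ω | Z t ω = u}) * ENNReal.ofReal (K h u v)

lemma measure_eq_sum_inter_fiber [MeasurableSpace Ω] (μ : Measure Ω) {f : Ω → W}
    (hf : ∀ w, MeasurableSet {ω | f ω = w}) (A : Set Ω) :
    μ A = ∑ w, μ (A ∩ {ω | f ω = w}) := by
  classical
  have hU : ⋃ w, {ω | f ω = w} = Set.univ := by
    ext ω
    simp
  have h := congrArg (fun ν : Measure Ω => ν A) (Measure.restrict_iUnion (μ := μ)
    (fun v w hvw => Set.disjoint_left.2 fun ω hv hw => hvw (hv.symm.trans hw)) hf)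
  simpa [hU, Measure.sum_apply_of_countable, Measure.restrict_apply' (hf _), tsum_fintype] using h

namespace IsMarkovWith

variable {m0 : MeasurableSpace Ω} {μ : Measure Ω} {F : ℝ≥0 → MeasurableSpace Ω}
  {Z : ℝ≥0 → Ω → W} {K : ℝ≥0 → Matrix W W ℝ}

lemma measurableSet_eq (h : IsMarkovWith μ F Z K) (t : ℝ≥0) (w : W) :
    MeasurableSet {ω | Z t ω = w} := h.le t _ (h.adapted t w)

lemma measure_inter_eq_mul (h : IsMarkovWith μ F Z K) {t u : ℝ≥0} {A : Set Ω}
    {w v : W} (hA : MeasurableSet[F t] A) (hAw : ∀ ω ∈ A, Z t ω = w) :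
    μ (A ∩ {ω | Z (t + u) ω = v}) = μ A * ENNReal.ofReal (K u w v) := by
  classical
  rw [h.markov t u v A hA, Finset.sum_eq_single w]
  · rw [Set.inter_eq_left.2 (show A ⊆ {ω | Z t ω = w} from hAw)]
  · intro b _ hb
    have : A ∩ {ω | Z t ω = b} = ∅ :=
      Set.eq_empty_of_forall_notMem fun ω hω => hb (hω.2.symm.trans (hAw ω hω.1))
    rw [this, measure_empty, zero_mul]
  · simp

/-- The probability of avoiding `s` along the grid of mesh `δ` started at time `t`. -/
lemma measure_inter_avoid [DecidableEq W] (h : IsMarkovWith μ F Z K) {δ : ℝ≥0}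
    (hK : ∀ x y, 0 ≤ K δ x y) (s : W) (m : ℕ) (t : ℝ≥0) {A : Set Ω} (hA : MeasurableSet[F t] A) :
    μ (A ∩ {ω | ∀ j < m, Z (t + j * δ) ω ≠ s}) =
      ∑ u, μ (A ∩ {ω | Z t ω = u}) * ENNReal.ofReal (avoid (K δ) s m u) := by
  induction m generalizing t A with
  | zero => simpa [avoid] using measure_eq_sum_inter_fiber μ (h.measurableSet_eq t) A
  | succ m ih =>
    have hA' : MeasurableSet[F t] (A ∩ {ω | Z t ω = s}ᶜ) := hA.inter (h.adapted t s).compl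
    have hset : A ∩ {ω | ∀ j < m + 1, Z (t + j * δ) ω ≠ s} =
        (A ∩ {ω | Z t ω = s}ᶜ) ∩ {ω | ∀ j < m, Z (t + δ + j * δ) ω ≠ s} := by
      ext ω
      have hj : ∀ j : ℕ, t + δ + j * δ = t + ((j + 1 : ℕ) : ℝ≥0) * δ := fun j => by
        push_cast
        ring
      simp only [Set.mem_inter_iff, Set.mem_ofPred_eq, Set.mem_compl_iff, hj, and_assoc]
      refine and_congr_right fun _ => ⟨fun H => ⟨by simpa using H 0 (by omega),
        fun j hj => H (j + 1) (by omega)⟩, fun H j hj => ?_⟩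
      cases j with
      | zero => simpa using H.1
      | succ j => exact H.2 j (by omega)
    have hu : ∀ u, μ ((A ∩ {ω | Z t ω = s}ᶜ) ∩ {ω | Z t ω = u}) =
        if u = s then 0 else μ (A ∩ {ω | Z t ω = u}) := fun u => by
      split_ifs with hus
      · subst hus
        rw [Set.inter_assoc, Set.compl_inter_self, Set.inter_empty, measure_empty]
      · congr 1
        ext ω
        simp only [Set.mem_inter_iff, Set.mem_compl_iff, Set.mem_ofPred_eq]
        refine ⟨fun H => ⟨H.1.1, H.2⟩, fun H => ⟨⟨H.1, fun H2 => hus (H.2.symm.trans H2)⟩, H.2⟩⟩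
    rw [hset, ih (t + δ) (h.mono le_self_add _ hA')]
    simp_rw [h.markov t δ _ _ hA', hu, Finset.sum_mul]
    rw [Finset.sum_comm]
    refine Finset.sum_congr rfl fun u _ => ?_
    rw [avoid]
    split_ifs
    · simp
    · rw [ENNReal.ofReal_sum_of_nonneg fun y _ => mul_nonneg (hK u y) (avoid_nonneg hK m y),
        Finset.mul_sum]
      exact Finset.sum_congr rfl fun y _ => by rw [ENNReal.ofReal_mul (hK u y), mul_assoc]

end IsMarkovWith

variable [DecidableEq W] [MeasurableSpace Ω] {Q : Matrix W W ℝ} {P : Measure Ω}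
  {X : ℝ≥0 → Ω → W} {x : W}

lemma IsMarkovChain.isMarkovWith (hX : IsMarkovChain Q P X x) :
    IsMarkovWith P (past X) X (transition Q) where
  le t := by
    refine iSup₂_le fun u _ => ?_
    rintro _ ⟨S, -, rfl⟩
    have : X u ⁻¹' S = ⋃ v ∈ S, {ω | X u ω = v} := by
      ext ω
      simp
    rw [this]
    exact MeasurableSet.biUnion S.to_countable fun v _ => hX.measurableSet_eq u v
  mono := fun t t' h => iSup₂_le fun u hu =>
    le_iSup₂_of_le (f := fun (u : ℝ≥0) (_ : u ≤ t') => MeasurableSpace.comap (X u) ⊤) u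
      (hu.trans h) le_rfl
  adapted t w :=
    le_iSup₂_of_le (f := fun (u : ℝ≥0) (_ : u ≤ t) => MeasurableSpace.comap (X u) ⊤) t le_rfl
      le_rfl _ ⟨{w}, trivial, rfl⟩
  markov := hX.markov

lemma IsMarkovChain.measure_start (hX : IsMarkovChain Q P X x) (u : W) :
    P {ω | X 0 ω = u} = if u = x then 1 else 0 := by
  have := hX.isProbabilityMeasure
  split_ifs with h
  · rw [h]
    exact (mem_ae_iff_prob_eq_one (hX.measurableSet_eq 0 x)).1 hX.start
  · rw [measure_eq_zero_iff_ae_notMem]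
    filter_upwards [hX.start] with ω hω hu
    exact h (hu.symm.trans hω)

/-- The existence of the chain forces the entries of `exp (t Q)` to be nonnegative. -/
lemma IsMarkovChain.transition_nonneg (hQ : IsGenerator Q) (hX : IsMarkovChain Q P X x)
    (t : ℝ≥0) (y : W) : 0 ≤ transition Q t x y := by
  have := hX.isProbabilityMeasure
  have h1 : ∀ v, P {ω | X t ω = v} = ENNReal.ofReal (transition Q t x v) := fun v => by
    simpa [hX.measure_start] using hX.markov 0 t v Set.univ MeasurableSet.univ
  have h2 := measure_eq_sum_inter_fiber P (hX.measurableSet_eq t) Set.univ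
  simp only [Set.univ_inter, h1, measure_univ] at h2
  have h3 : ∑ v, max (transition Q t x v) 0 = 1 := by
    have := congrArg ENNReal.toReal h2
    rw [ENNReal.toReal_sum (fun _ _ => ENNReal.ofReal_ne_top)] at this
    simpa [ENNReal.toReal_ofReal'] using this.symm
  have h4 := (Finset.sum_eq_sum_iff_of_le (s := Finset.univ)
    fun v _ => le_max_left (transition Q t x v) 0).1 (by rw [h3, hQ.sum_transition])
  rw [h4 y (Finset.mem_univ y)]
  exact le_max_right _ _

/-- A visit to `s` before time `t` is seen on all sufficiently fine dyadic grids, because the paths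
are right-continuous and take finitely many values. -/
lemma IsMarkovChain.exists_dyadic (hX : IsMarkovChain Q P X x) {s : W} {ω : Ω} {u t : ℝ≥0}
    (hut : u < t) (hu : X u ω = s) :
    ∃ i j : ℕ, j < 2 ^ i ∧ X (j * (t / 2 ^ i)) ω = s := by
  obtain ⟨b, hub, hb⟩ := (mem_nhdsGT_iff_exists_Ioo_subset' hut).1 (hX.right_continuous ω u)
  have ht : 0 < t := hut.bot_lt
  have hb' : 0 < (min b t - u) / t := div_pos (tsub_pos_of_lt (lt_min hub hut)) ht
  obtain ⟨i, hi⟩ := exists_pow_lt_of_lt_one hb' (show (1 / 2 : ℝ≥0) < 1 by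
    rw [div_lt_one] <;> norm_num)
  have h2 : (0 : ℝ≥0) < t / 2 ^ i := by positivity
  have hi' : t / 2 ^ i < min b t - u := by
    rw [lt_div_iff₀ ht, one_div, inv_pow] at hi
    rwa [div_eq_inv_mul]
  set j := ⌊u / (t / 2 ^ i)⌋₊ + 1
  have hj1 : u < j * (t / 2 ^ i) := by
    rw [← div_lt_iff₀ h2]
    have := Nat.lt_floor_add_one (u / (t / 2 ^ i))
    simpa only [j, Nat.cast_add, Nat.cast_one] using this
  have hj2 : j * (t / 2 ^ i) < min b t := by
    have h3 : (⌊u / (t / 2 ^ i)⌋₊ : ℝ≥0) * (t / 2 ^ i) ≤ u := by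
      rw [← le_div_iff₀ h2]
      exact Nat.floor_le zero_le
    have h4 : (j : ℝ≥0) * (t / 2 ^ i) = ⌊u / (t / 2 ^ i)⌋₊ * (t / 2 ^ i) + t / 2 ^ i := by
      simp only [j]
      push_cast
      ring
    rw [h4]
    calc _ ≤ u + t / 2 ^ i := by gcongr
      _ < u + (min b t - u) := by gcongr
      _ = _ := add_tsub_cancel_of_le (lt_min hub hut).le
  refine ⟨i, j, ?_, (hb ⟨hj1, hj2.trans_le (min_le_left _ _)⟩).trans hu⟩
  have h5 := hj2.trans_le (min_le_right _ _)
  rw [mul_div_assoc', div_lt_iff₀ (by positivity), mul_comm, mul_lt_mul_iff_right₀ ht] at h5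
  exact_mod_cast h5

/-- Markov's inequality for the hitting time: the chain avoids `s` at the dyadic subdivisions of
`[0, t)` with probability at most `E T_s / t`. -/
lemma IsMarkovChain.mul_measure_le_lintegral_hitTime (hX : IsMarkovChain Q P X x) (s : W)
    (t : ℝ≥0) :
    t * P {ω | ∀ i j : ℕ, j < 2 ^ i → X (j * (t / 2 ^ i)) ω ≠ s} ≤ ∫⁻ ω, hitTime X s ω ∂P := by
  have hm : MeasurableSet {ω | ∀ i j : ℕ, j < 2 ^ i → X (j * (t / 2 ^ i)) ω ≠ s} := by
    have : {ω | ∀ i j : ℕ, j < 2 ^ i → X (j * (t / 2 ^ i)) ω ≠ s} =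
        ⋂ i : ℕ, ⋂ j : ℕ, ⋂ (_ : j < 2 ^ i), {ω | X (j * (t / 2 ^ i)) ω = s}ᶜ := by
      ext ω
      simp
    rw [this]
    exact MeasurableSet.iInter fun i => MeasurableSet.iInter fun j => MeasurableSet.iInter fun _ =>
      (hX.measurableSet_eq _ _).compl
  have hle : ∀ ω ∈ {ω | ∀ i j : ℕ, j < 2 ^ i → X (j * (t / 2 ^ i)) ω ≠ s},
      (t : ℝ≥0∞) ≤ hitTime X s ω := fun ω hω => by
    refine le_iInf₂ fun u hu => ?_
    by_contra! hut
    obtain ⟨i, j, hj, hij⟩ := hX.exists_dyadic (ENNReal.coe_lt_coe.1 hut) hu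
    exact hω i j hj hij
  rw [← lintegral_indicator_const hm]
  exact lintegral_mono fun ω => Set.indicator_le hle ω

/-- The bound for the hitting time, transferred to a fine dyadic grid. -/
lemma IsMarkovChain.eventually_avoid_lt (hX : IsMarkovChain Q P X x)
    (hnn : ∀ t x y, 0 ≤ transition Q t x y) {s : W} {t : ℝ≥0} {c : ℝ}
    (hc : ∫⁻ ω, hitTime X s ω ∂P < t * ENNReal.ofReal c) :
    ∀ᶠ i : ℕ in atTop, avoid (transition Q (t / 2 ^ i)) s (2 ^ i) x < c := by
  have := hX.isProbabilityMeasure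
  set E : ℕ → Set Ω := fun i => {ω | ∀ j : ℕ, j < 2 ^ i → X (j * (t / 2 ^ i)) ω ≠ s} with hE
  have hEm : ∀ i, MeasurableSet (E i) := fun i => by
    have : E i = ⋂ j : ℕ, ⋂ (_ : j < 2 ^ i), {ω | X (j * (t / 2 ^ i)) ω = s}ᶜ := by
      ext ω
      simp [E]
    rw [this]
    exact MeasurableSet.iInter fun j => MeasurableSet.iInter fun _ =>
      (hX.measurableSet_eq _ _).compl
  have hanti : Antitone E := antitone_nat_of_succ_le fun i ω hω j hj => by
    have h := hω (2 * j) (by rw [pow_succ]; omega)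
    have hj2 : ((2 * j : ℕ) : ℝ≥0) * (t / 2 ^ (i + 1)) = j * (t / 2 ^ i) := by
      push_cast
      field_simp
      ring
    rwa [hj2] at h
  have hPE : ∀ i, P (E i) = ENNReal.ofReal (avoid (transition Q (t / 2 ^ i)) s (2 ^ i) x) :=
    fun i => by
    have h := hX.isMarkovWith.measure_inter_avoid (hnn (t / 2 ^ i)) s (2 ^ i) 0
      MeasurableSet.univ
    simpa [hX.measure_start] using h
  have hlim : Tendsto (P ∘ E) atTop (𝓝 (P (⋂ i, E i))) :=
    tendsto_measure_iInter_atTop (fun i => (hEm i).nullMeasurableSet) hanti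
      ⟨0, measure_ne_top _ _⟩
  have hinter : ⋂ i, E i = {ω | ∀ i j : ℕ, j < 2 ^ i → X (j * (t / 2 ^ i)) ω ≠ s} := by
    ext ω
    simp [E]
  have hlt : P (⋂ i, E i) < ENNReal.ofReal c := by
    rw [hinter]
    exact lt_of_mul_lt_mul_left' ((hX.mul_measure_le_lintegral_hitTime s t).trans_lt hc)
  filter_upwards [hlim.eventually (gt_mem_nhds hlt)] with i hi
  rw [Function.comp_apply, hPE] at hi
  exact (ENNReal.ofReal_lt_ofReal_iff_of_nonneg (avoid_nonneg (hnn _) _ _)).1 hi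

end Markov

/-- On a fine grid, every start has probability at least `5/7` of visiting `s` within four times
the maximal expected hitting time. -/
lemma exists_avoid_le {V Ω : Type*} [Fintype V] [DecidableEq V] [MeasurableSpace Ω]
    {Q : Matrix V V ℝ} {P : V → Measure Ω} {X : ℝ≥0 → Ω → V}
    (hX : ∀ x, IsMarkovChain Q (P x) X x) (hnn : ∀ t x y, 0 ≤ transition Q t x y) {s : V}
    {H : ℝ≥0} (hH : expHit P X s = H) (hH0 : 0 < H) :
    ∃ (δ : ℝ≥0) (l : ℕ), 0 < l ∧ l * δ = 4 * H ∧
      ∀ x, 5 / 7 ≤ 1 - avoid (transition Q δ) s l x := by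
  have h4 : 0 < 4 * H := by positivity
  -- Markov's inequality bounds the avoidance probability by `1 / 4`; the slack up to `2 / 7` pays
  -- for the discretization.
  have hx : ∀ x, ∀ᶠ i : ℕ in atTop,
      avoid (transition Q (4 * H / 2 ^ i)) s (2 ^ i) x < 2 / 7 := fun x => by
    refine (hX x).eventually_avoid_lt hnn (lt_of_le_of_lt
      ((le_iSup (fun x => ∫⁻ ω, hitTime X s ω ∂(P x)) x).trans hH.le) ?_)
    have hr : ENNReal.ofReal (2 / 7) = ((2 / 7 : ℝ≥0) : ℝ≥0∞) := by
      rw [ENNReal.ofReal]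
      congr 1
      ext
      norm_num
    rw [hr, ← ENNReal.coe_mul, ENNReal.coe_lt_coe, ← NNReal.coe_lt_coe]
    push_cast
    have : (0 : ℝ) < H := hH0
    linarith
  obtain ⟨i, hi⟩ := (eventually_all.2 hx).exists
  refine ⟨4 * H / 2 ^ i, 2 ^ i, by positivity, ?_, fun x => by linarith [hi x]⟩
  push_cast
  field_simp

/-- If `s` is hit in expected time zero from every start, there is only one state: a chain started
elsewhere stays away from `s` for a positive time. -/
lemma subsingleton_of_expHit_eq_zero {V Ω : Type*} [Fintype V] [DecidableEq V]
    [MeasurableSpace Ω] {Q : Matrix V V ℝ} {P : V → Measure Ω} {X : ℝ≥0 → Ω → V}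
    (hX : ∀ x, IsMarkovChain Q (P x) X x) {s : V} (h0 : expHit P X s = 0) : Subsingleton V := by
  refine subsingleton_of_forall_eq s fun x => by_contra fun hxs => ?_
  have := (hX x).isProbabilityMeasure
  have hint : ∫⁻ ω, hitTime X s ω ∂(P x) = 0 :=
    le_antisymm ((le_iSup (fun x => ∫⁻ ω, hitTime X s ω ∂(P x)) x).trans h0.le) zero_le
  have hA : ∀ m : ℕ, P x {ω | ∀ i j : ℕ, j < 2 ^ i →
      X (j * ((1 / (m + 1 : ℝ≥0)) / 2 ^ i)) ω ≠ s} = 0 := fun m => by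
    have h := (hX x).mul_measure_le_lintegral_hitTime s (1 / (m + 1 : ℝ≥0))
    rw [hint, nonpos_iff_eq_zero, mul_eq_zero] at h
    refine h.resolve_left ?_
    rw [ENNReal.coe_eq_zero]
    positivity
  have hU := measure_iUnion_null hA
  refine one_ne_zero (α := ℝ≥0∞) ?_
  rw [← measure_univ (μ := P x), ← nonpos_iff_eq_zero, ← hU]
  refine measure_mono_ae ?_
  filter_upwards [(hX x).start] with ω hω _
  obtain ⟨b, hb0, hb⟩ :=
    (mem_nhdsGT_iff_exists_Ioo_subset' zero_lt_one).1 ((hX x).right_continuous ω 0)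
  obtain ⟨m, hm⟩ := exists_nat_one_div_lt (Set.mem_Ioi.1 hb0)
  refine Set.mem_iUnion.2 ⟨m, fun i j hj hjs => hxs ?_⟩
  rcases Nat.eq_zero_or_pos j with rfl | hj0
  · rw [Nat.cast_zero, zero_mul] at hjs
    exact hω.symm.trans hjs
  · refine hω.symm.trans ((hb ⟨by positivity, lt_of_le_of_lt ?_ hm⟩).symm.trans hjs)
    have hj' : (j : ℝ≥0) ≤ 2 ^ i := by exact_mod_cast hj.le
    calc (j : ℝ≥0) * (1 / (m + 1 : ℝ≥0) / 2 ^ i) ≤ 2 ^ i * (1 / (m + 1 : ℝ≥0) / 2 ^ i) := by gcongr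
      _ = 1 / (m + 1 : ℝ≥0) := by field_simp

/-! ### Independent Markov processes and their meeting time -/

section Product

open scoped Kronecker

variable {Ω₁ Ω₂ W₁ W₂ : Type*} [Fintype W₁] [Fintype W₂] {m₁ : MeasurableSpace Ω₁}
  {m₂ : MeasurableSpace Ω₂} {μ₁ : Measure Ω₁} {μ₂ : Measure Ω₂} [IsFiniteMeasure μ₁]
  [IsFiniteMeasure μ₂] {F₁ : ℝ≥0 → MeasurableSpace Ω₁} {F₂ : ℝ≥0 → MeasurableSpace Ω₂}
  {Z₁ : ℝ≥0 → Ω₁ → W₁} {Z₂ : ℝ≥0 → Ω₂ → W₂} {K₁ : ℝ≥0 → Matrix W₁ W₁ ℝ}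
  {K₂ : ℝ≥0 → Matrix W₂ W₂ ℝ}

/-- Two independent Markov processes form a Markov process. -/
lemma IsMarkovWith.prod (h₁ : IsMarkovWith μ₁ F₁ Z₁ K₁) (h₂ : IsMarkovWith μ₂ F₂ Z₂ K₂)
    (hK : ∀ t x y, 0 ≤ K₁ t x y) :
    IsMarkovWith (μ₁.prod μ₂) (fun t => (F₁ t).prod (F₂ t))
      (fun t ω => (Z₁ t ω.1, Z₂ t ω.2)) (fun t => K₁ t ⊗ₖ K₂ t) := by
  have hle : ∀ t, (F₁ t).prod (F₂ t) ≤ m₁.prod m₂ := fun t =>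
    sup_le_sup (MeasurableSpace.comap_mono (h₁.le t)) (MeasurableSpace.comap_mono (h₂.le t))
  have hfib : ∀ t (v : W₁ × W₂), {ω : Ω₁ × Ω₂ | (Z₁ t ω.1, Z₂ t ω.2) = v} =
      {ω | Z₁ t ω = v.1} ×ˢ {ω | Z₂ t ω = v.2} := fun t v => by
    ext ω
    simp [Prod.ext_iff]
  have hfibm : ∀ t (v : W₁ × W₂), MeasurableSet[(F₁ t).prod (F₂ t)]
      {ω : Ω₁ × Ω₂ | (Z₁ t ω.1, Z₂ t ω.2) = v} := fun t v => by
    rw [hfib]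
    exact @MeasurableSet.prod _ _ (F₁ t) (F₂ t) _ _ (h₁.adapted t _) (h₂.adapted t _)
  refine ⟨hle, fun t t' h => sup_le_sup (MeasurableSpace.comap_mono (h₁.mono h))
    (MeasurableSpace.comap_mono (h₂.mono h)), hfibm, fun t h v A hA => ?_⟩
  -- Both sides are finite measures on the product σ-algebra; they agree on rectangles.
  set μ := μ₁.prod μ₂
  let ν : Measure[(F₁ t).prod (F₂ t)] (Ω₁ × Ω₂) :=
    (μ.restrict {ω | (Z₁ (t + h) ω.1, Z₂ (t + h) ω.2) = v}).trim (hle t)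
  let ν' : Measure[(F₁ t).prod (F₂ t)] (Ω₁ × Ω₂) :=
    ∑ u, ENNReal.ofReal ((K₁ h ⊗ₖ K₂ h) u v) •
      (μ.restrict {ω | (Z₁ t ω.1, Z₂ t ω.2) = u}).trim (hle t)
  have hν : ∀ B, MeasurableSet[(F₁ t).prod (F₂ t)] B →
      ν B = μ (B ∩ {ω | (Z₁ (t + h) ω.1, Z₂ (t + h) ω.2) = v}) := fun B hB => by
    rw [trim_measurableSet_eq _ hB, Measure.restrict_apply (hle t _ hB)]
  have hν' : ∀ B, MeasurableSet[(F₁ t).prod (F₂ t)] B →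
      ν' B = ∑ u, μ (B ∩ {ω | (Z₁ t ω.1, Z₂ t ω.2) = u}) *
        ENNReal.ofReal ((K₁ h ⊗ₖ K₂ h) u v) := fun B hB => by
    simp only [ν', Measure.coe_finsetSum, Finset.sum_apply, Measure.smul_apply, smul_eq_mul]
    refine Finset.sum_congr rfl fun u _ => ?_
    rw [trim_measurableSet_eq _ hB, Measure.restrict_apply (hle t _ hB), mul_comm]
  have hrect : ∀ (A₁ : Set Ω₁) (A₂ : Set Ω₂), MeasurableSet[F₁ t] A₁ → MeasurableSet[F₂ t] A₂ →
      ν (A₁ ×ˢ A₂) = ν' (A₁ ×ˢ A₂) := fun A₁ A₂ hA₁ hA₂ => by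
    have hA := @MeasurableSet.prod _ _ (F₁ t) (F₂ t) _ _ hA₁ hA₂
    rw [hν _ hA, hν' _ hA]
    simp only [hfib, Set.prod_inter_prod, μ, Measure.prod_prod, h₁.markov t h v.1 A₁ hA₁,
      h₂.markov t h v.2 A₂ hA₂, Finset.sum_mul_sum, Fintype.sum_prod_type,
      Matrix.kroneckerMap_apply, ENNReal.ofReal_mul (hK _ _ _)]
    refine Finset.sum_congr rfl fun u₁ _ => Finset.sum_congr rfl fun u₂ _ => by ring
  have hνν' : ν = ν' := by
    refine @ext_of_generate_finite _ ((F₁ t).prod (F₂ t)) ν ν' _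
      (@generateFrom_prod _ _ (F₁ t) (F₂ t)).symm (@isPiSystem_prod _ _ (F₁ t) (F₂ t))
      inferInstance ?_ ?_
    · rintro _ ⟨A₁, hA₁, A₂, hA₂, rfl⟩
      exact hrect A₁ A₂ hA₁ hA₂
    · rw [← Set.univ_prod_univ]
      exact hrect _ _ MeasurableSet.univ MeasurableSet.univ
  rw [← hν A hA, ← hν' A hA, hνν']

/-- A Markov process stays Markov when its filtration is enlarged by independent randomness. -/
lemma IsMarkovWith.prod_randomness (h₁ : IsMarkovWith μ₁ F₁ Z₁ K₁)
    (hK : ∀ t x y, 0 ≤ K₁ t x y) :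
    IsMarkovWith (μ₁.prod μ₂) (fun t => (F₁ t).prod m₂) (fun t ω => Z₁ t ω.1) K₁ := by
  have h₂ : IsMarkovWith μ₂ (fun _ => m₂) (fun _ _ => ()) (fun _ => (1 : Matrix Unit Unit ℝ)) :=
    ⟨fun _ => le_rfl, fun _ _ _ => le_rfl, fun _ _ => by simp, fun _ _ _ _ _ => by simp⟩
  have h := h₁.prod h₂ hK
  refine ⟨h.le, h.mono, fun t w => by simpa using h.adapted t (w, ()), fun t u v A hA => ?_⟩
  simpa [Fintype.sum_prod_type] using h.markov t u (v, ()) A hA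

end Product

section Hitting

variable {Ω W : Type*} [Fintype W] [DecidableEq W] {m0 : MeasurableSpace Ω} {μ : Measure Ω}
  [IsProbabilityMeasure μ] {F : ℝ≥0 → MeasurableSpace Ω} {Z : ℝ≥0 → Ω → W}
  {K : ℝ≥0 → Matrix W W ℝ}

/-- If from every state a grid of `m` steps of length `δ` hits `w` with probability at least `ρ`,
then any time that never exceeds the first visit to `w` along the grid has expectation at most
`m δ / ρ`. -/
lemma IsMarkovWith.lintegral_le_of_avoid_le (h : IsMarkovWith μ F Z K) {δ : ℝ≥0}
    (hδ : 0 < δ) (hK : ∀ x y, 0 ≤ K δ x y) {w : W} {m : ℕ} (hm : 0 < m) {ρ : ℝ}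
    (hρ1 : ρ ≤ 1) (hρ : ∀ u, ρ ≤ 1 - avoid (K δ) w m u) {τ : Ω → ℝ≥0∞}
    (hτ : ∀ (k : ℕ) ω, Z (k * δ) ω = w → τ ω ≤ (k * δ : ℝ≥0)) :
    ∫⁻ ω, τ ω ∂μ ≤ (m * δ : ℝ≥0) * (ENNReal.ofReal ρ)⁻¹ := by
  -- `B i` is the event that `w` is not visited during the first `i` blocks of `m` steps.
  set B : ℕ → Set Ω := fun i => {ω | ∀ j : ℕ, j < i * m → Z (j * δ) ω ≠ w} with hB
  have hBF : ∀ i : ℕ, MeasurableSet[F ((i * m : ℕ) * δ)] (B i) := fun i => by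
    have : B i = ⋂ j : ℕ, ⋂ (_ : j < i * m), {ω | Z (j * δ) ω = w}ᶜ := by
      ext ω
      simp [B]
    rw [this]
    refine MeasurableSet.iInter fun j => MeasurableSet.iInter fun hj =>
      (h.mono ?_ _ (h.adapted _ _)).compl
    gcongr
  have hstep : ∀ i, μ (B (i + 1)) ≤ ENNReal.ofReal (1 - ρ) * μ (B i) := fun i => by
    have hset : B (i + 1) ⊆
        B i ∩ {ω | ∀ j : ℕ, j < m → Z ((i * m : ℕ) * δ + j * δ) ω ≠ w} := fun ω hω => by
      refine ⟨fun j hj => hω j (by rw [add_mul]; omega), fun j hj => ?_⟩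
      have := hω (i * m + j) (by rw [add_mul]; omega)
      rwa [Nat.cast_add, add_mul] at this
    refine (measure_mono hset).trans ?_
    rw [h.measure_inter_avoid hK w m _ (hBF i),
      measure_eq_sum_inter_fiber μ (h.measurableSet_eq ((i * m : ℕ) * δ)) (B i), Finset.mul_sum]
    refine Finset.sum_le_sum fun u _ => ?_
    rw [mul_comm]
    gcongr
    linarith [hρ u]
  have hpow : ∀ i, μ (B i) ≤ ENNReal.ofReal (1 - ρ) ^ i := fun i => by
    induction i with
    | zero => simpa using prob_le_one
    | succ i ih =>
      rw [pow_succ']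
      exact (hstep i).trans (by gcongr)
  have hBm : ∀ i, MeasurableSet (B i) := fun i => h.le _ _ (hBF i)
  have hpt : ∀ ω, τ ω ≤ (m * δ : ℝ≥0) * ∑' i, (B i).indicator 1 ω := fun ω => by
    have hmδ : (m * δ : ℝ≥0) ≠ 0 := by positivity
    by_cases hex : ∃ k : ℕ, Z (k * δ) ω = w
    · classical
      set k := Nat.find hex
      have h1 : ∀ i ∈ Finset.range (k / m + 1), (B i).indicator (1 : Ω → ℝ≥0∞) ω = 1 :=
        fun i hi => by
        have hω : ω ∈ B i := fun j (hj : j < i * m) => Nat.find_min hex (hj.trans_le ?_)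
        · exact Set.indicator_of_mem hω _
        exact (Nat.le_div_iff_mul_le hm).1 (Nat.lt_succ_iff.1 (Finset.mem_range.1 hi))
      have h2 : ((k / m + 1 : ℕ) : ℝ≥0∞) ≤ ∑' i, (B i).indicator 1 ω := by
        refine le_trans ?_ (ENNReal.sum_le_tsum (Finset.range (k / m + 1)))
        rw [Finset.sum_congr rfl h1]
        simp
      refine (hτ k ω (Nat.find_spec hex)).trans (le_trans ?_ (mul_le_mul_right h2 _))
      rw [← ENNReal.coe_natCast, ← ENNReal.coe_mul, ENNReal.coe_le_coe]
      have h3 : k ≤ m * (k / m + 1) := (Nat.lt_mul_div_succ k hm).le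
      calc (k : ℝ≥0) * δ ≤ ((m * (k / m + 1) : ℕ) : ℝ≥0) * δ := by gcongr
        _ = _ := by
          push_cast
          ring
    · have h1 : ∀ i, (B i).indicator (1 : Ω → ℝ≥0∞) ω = 1 := fun i =>
        Set.indicator_of_mem (show ω ∈ B i from fun j _ hj => hex ⟨j, hj⟩) _
      simp only [h1, ENNReal.tsum_const_eq_top_of_ne_zero one_ne_zero]
      rw [ENNReal.mul_top (by exact_mod_cast hmδ)]
      exact le_top
  calc ∫⁻ ω, τ ω ∂μ ≤ ∫⁻ ω, (m * δ : ℝ≥0) * ∑' i, (B i).indicator 1 ω ∂μ := lintegral_mono hpt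
    _ = (m * δ : ℝ≥0) * ∑' i, μ (B i) := by
      rw [lintegral_const_mul' _ _ ENNReal.coe_ne_top,
        lintegral_tsum fun i => (measurable_one.indicator (hBm i)).aemeasurable]
      simp only [lintegral_indicator_one (hBm _)]
    _ ≤ (m * δ : ℝ≥0) * ∑' i, ENNReal.ofReal (1 - ρ) ^ i := by
      gcongr with i
      exact hpow i
    _ ≤ _ := by
      rw [ENNReal.tsum_geometric]
      rw [← ENNReal.ofReal_one, ← ENNReal.ofReal_sub _ (sub_nonneg.2 hρ1), sub_sub_cancel]

end Hitting

open scoped Kronecker in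
/-- The copies have met once both are at `s`, so the hitting time of `(s, s)` by the pair bounds the
meeting time. -/
lemma expMeet_le {V Ω : Type*} [Fintype V] [DecidableEq V] [MeasurableSpace Ω]
    {Q : Matrix V V ℝ} {π : V → ℝ} {P : V → Measure Ω} {X : ℝ≥0 → Ω → V}
    (hQ : IsGenerator Q) (hπ : IsInvariant Q π)
    (hrev : IsReversible Q π) (hpos : ∀ i, 0 < π i) (hnn : ∀ t x y, 0 ≤ transition Q t x y)
    (hX : ∀ x, IsMarkovChain Q (P x) X x) {δ : ℝ≥0} (hδ : 0 < δ) {l : ℕ} (hl : 0 < l) {s : V}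
    {c : ℝ} (hc0 : 0 ≤ c) (hc : ∀ x, c ≤ 1 - avoid (transition Q δ) s l x) :
    expMeet P X ≤ (3 * (l * δ) : ℝ≥0) * (ENNReal.ofReal (c ^ 3 * π s / 2))⁻¹ := by
  refine iSup₂_le fun x y => ?_
  have := (hX x).isProbabilityMeasure
  have := (hX y).isProbabilityMeasure
  have hK : ∀ u v, 0 ≤ (transition Q δ ⊗ₖ transition Q δ) u v :=
    fun _ _ => mul_nonneg (hnn _ _ _) (hnn _ _ _)
  have hρ := le_one_sub_avoid_kronecker hQ hπ hrev hpos hnn hl hc0 hc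
  have h := ((hX x).isMarkovWith.prod (hX y).isMarkovWith hnn).lintegral_le_of_avoid_le hδ
    hK (m := 3 * l) (by omega)
    ((hρ (x, y)).trans (sub_le_self _ (avoid_nonneg hK _ _))) hρ
    (τ := meetTime (fun t (ω : Ω × Ω) => X t ω.1) (fun t ω => X t ω.2))
    (fun k ω hk => iInf₂_le (k * δ) ((congrArg Prod.fst hk).trans (congrArg Prod.snd hk).symm))
  rwa [Nat.cast_mul, mul_assoc, Nat.cast_ofNat] at h

/-! ### Restarting a Markov process -/

section Restart

variable {Ω W : Type*} [Fintype W] [MeasurableSpace W]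
  {m0 : MeasurableSpace Ω} {μ : Measure Ω} {F : ℝ≥0 → MeasurableSpace Ω} {Z : ℝ≥0 → Ω → W}
  {K : ℝ≥0 → Matrix W W ℝ}

lemma IsMarkovWith.measurable (h : IsMarkovWith μ F Z K) (t : ℝ≥0) : Measurable (Z t) :=
  measurable_to_countable' fun w => h.measurableSet_eq t w

lemma IsMarkovWith.measurable_path (h : IsMarkovWith μ F Z K) (r : ℝ≥0) :
    Measurable fun ω (t : ℝ≥0) => Z (t + r) ω :=
  measurable_pi_lambda _ fun t => h.measurable (t + r)

/-- The law of the future of a Markov process restarted at a deterministic time `r` on an event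
`D` of the past depends, up to a constant, only on the law of the state at time `r` on `D`. -/
lemma IsMarkovWith.measure_inter_path_eq [MeasurableSingletonClass W] [IsFiniteMeasure μ]
    (h : IsMarkovWith μ F Z K) {r r' : ℝ≥0} {D D' : Set Ω} (hD : MeasurableSet[F r] D)
    (hD' : MeasurableSet[F r'] D') {α α' : ℝ≥0∞} (hα : α ≠ ∞) (hα' : α' ≠ ∞)
    (hDD : ∀ v, α * μ (D ∩ {ω | Z r ω = v}) = α' * μ (D' ∩ {ω | Z r' ω = v}))
    {C : Set (ℝ≥0 → W)} (hC : MeasurableSet C) :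
    α * μ (D ∩ (fun ω t => Z (t + r) ω) ⁻¹' C) =
      α' * μ (D' ∩ (fun ω t => Z (t + r') ω) ⁻¹' C) := by
  rcases isEmpty_or_nonempty Ω with hΩ | ⟨⟨ω₀⟩⟩
  · simp [Measure.eq_zero_of_isEmpty μ]
  have : Nonempty W := ⟨Z 0 ω₀⟩
  have hE : ∀ (r : ℝ≥0) (D : Set Ω), MeasurableSet[F r] D → ∀ (I : Finset ℝ≥0) (w : ℝ≥0 → W)
      (b : ℝ≥0), (∀ i ∈ I, i ≤ b) →
      MeasurableSet[F (b + r)] (D ∩ {ω | ∀ i ∈ I, Z (i + r) ω = w i}) :=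
    fun r D hD I w b hb => by
    have : {ω | ∀ i ∈ I, Z (i + r) ω = w i} = ⋂ i ∈ I, {ω | Z (i + r) ω = w i} := by
      ext ω
      simp
    rw [this]
    exact (h.mono le_add_self _ hD).inter (Finset.measurableSet_biInter I fun i hi =>
      h.mono (add_le_add_left (hb i hi) r) _ (h.adapted _ _))
  -- Equality on cylinders, by induction on the largest time of the cylinder.
  have key : ∀ (I : Finset ℝ≥0) (w : ℝ≥0 → W) (b : ℝ≥0), (∀ i ∈ I, i ≤ b) → ∀ v,
      α * μ (D ∩ {ω | ∀ i ∈ I, Z (i + r) ω = w i} ∩ {ω | Z (b + r) ω = v}) =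
        α' * μ (D' ∩ {ω | ∀ i ∈ I, Z (i + r') ω = w i} ∩ {ω | Z (b + r') ω = v}) := by
    intro I
    induction I using Finset.induction_on_max with
    | empty =>
      intro w b _ v
      have hs : ∀ (r : ℝ≥0) (D : Set Ω), MeasurableSet[F r] D →
          μ (D ∩ {ω | ∀ i ∈ (∅ : Finset ℝ≥0), Z (i + r) ω = w i} ∩ {ω | Z (b + r) ω = v}) =
            ∑ u, μ (D ∩ {ω | Z r ω = u}) * ENNReal.ofReal (K b u v) := fun r D hD => by
        rw [← h.markov r b v D hD, add_comm b r]
        simp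
      simp_rw [hs r D hD, hs r' D' hD', Finset.mul_sum, ← mul_assoc, hDD]
    | insert a I haI ih =>
      intro w b hb v
      have hab : a ≤ b := hb a (Finset.mem_insert_self a I)
      have hs : ∀ (r : ℝ≥0) (D : Set Ω), MeasurableSet[F r] D →
          μ (D ∩ {ω | ∀ i ∈ insert a I, Z (i + r) ω = w i} ∩ {ω | Z (b + r) ω = v}) =
            μ (D ∩ {ω | ∀ i ∈ I, Z (i + r) ω = w i} ∩ {ω | Z (a + r) ω = w a}) *
              ENNReal.ofReal (K (b - a) (w a) v) := fun r D hD => by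
        rw [← h.measure_inter_eq_mul ((hE r D hD I w a fun i hi => (haI i hi).le).inter
          (h.adapted (a + r) (w a))) fun ω hω => hω.2]
        have hbr : a + r + (b - a) = b + r := by
          rw [add_right_comm, add_tsub_cancel_of_le hab]
        rw [hbr]
        congr 1
        ext ω
        simp only [Finset.forall_mem_insert, Set.mem_inter_iff, Set.mem_ofPred_eq]
        tauto
      rw [hs r D hD, hs r' D' hD', ← mul_assoc, ← mul_assoc, ih w a fun i hi => (haI i hi).le]
  have hfin : ∀ (I : Finset ℝ≥0) (w : ℝ≥0 → W),
      α * μ (D ∩ {ω | ∀ i ∈ I, Z (i + r) ω = w i}) =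
        α' * μ (D' ∩ {ω | ∀ i ∈ I, Z (i + r') ω = w i}) := fun I w => by
    rw [measure_eq_sum_inter_fiber μ (h.measurableSet_eq (I.sup id + r)),
      measure_eq_sum_inter_fiber μ (h.measurableSet_eq (I.sup id + r')), Finset.mul_sum,
      Finset.mul_sum]
    exact Finset.sum_congr rfl fun v _ => key I w _ (fun i hi => Finset.le_sup (f := id) hi) v
  let ν : ℝ≥0∞ → Set Ω → ℝ≥0 → Measure (ℝ≥0 → W) := fun α D r =>
    α • (μ.restrict D).map fun ω t => Z (t + r) ω
  have hν : ∀ (α : ℝ≥0∞) (D : Set Ω) (r : ℝ≥0) {C : Set (ℝ≥0 → W)}, MeasurableSet C →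
      MeasurableSet D →
      ν α D r C = α * μ (D ∩ (fun ω t => Z (t + r) ω) ⁻¹' C) := fun α D r C hC hDm => by
    simp only [ν, Measure.smul_apply, smul_eq_mul]
    rw [Measure.map_apply (h.measurable_path r) hC, Measure.restrict_apply' hDm, Set.inter_comm]
  have hDm := h.le _ _ hD
  have hDm' := h.le _ _ hD'
  have : IsFiniteMeasure (ν α D r) := Measure.smul_finite _ hα
  have : IsFiniteMeasure (ν α' D' r') := Measure.smul_finite _ hα'
  have hproj : ∀ I : Finset ℝ≥0, (ν α D r).map I.restrict = (ν α' D' r').map I.restrict :=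
    fun I => by
    refine Measure.ext_of_singleton fun w => ?_
    obtain ⟨w', rfl⟩ : ∃ w' : ℝ≥0 → W, I.restrict w' = w := by
      classical
      exact ⟨fun i => if hi : i ∈ I then w ⟨i, hi⟩ else Classical.arbitrary W,
        funext fun i => by simp⟩
    have hI : Measurable (I.restrict : (ℝ≥0 → W) → (I → W)) := Finset.measurable_restrict I
    have hset : ∀ r : ℝ≥0, (fun ω t => Z (t + r) ω) ⁻¹'
        ((I.restrict : (ℝ≥0 → W) → (I → W)) ⁻¹' {I.restrict w'}) =
        {ω | ∀ i ∈ I, Z (i + r) ω = w' i} := fun r => by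
      ext ω
      simp [funext_iff]
    rw [Measure.map_apply hI (measurableSet_singleton _),
      Measure.map_apply hI (measurableSet_singleton _),
      hν _ _ _ (hI (measurableSet_singleton _)) hDm, hν _ _ _ (hI (measurableSet_singleton _)) hDm',
      hset, hset, hfin]
  have hνν : ν α D r = ν α' D' r' :=
    IsProjectiveLimit.unique (P := fun I => (ν α' D' r').map I.restrict) hproj fun I => rfl
  rw [← hν α D r hC hDm, ← hν α' D' r' hC hDm', hνν]

end Restart

/-! ### A strong stationary time from a minorization -/

section StrongStationary

/-- The probability, given the trajectory `z` of the skeleton chain, that no success has occurred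
in the first `k` steps, when a step from `u` to `v` is a success with probability `a u v`. -/
def survival {W : Type*} (a : W → W → ℝ) (z : ℕ → W) : ℕ → ℝ
  | 0 => 1
  | k + 1 => survival a z k * (1 - a (z k) (z (k + 1)))

section

variable {W : Type*} {a : W → W → ℝ}

lemma survival_nonneg (ha : ∀ u v, a u v ≤ 1) (z : ℕ → W) (k : ℕ) : 0 ≤ survival a z k := by
  induction k with
  | zero => exact zero_le_one
  | succ k ih => exact mul_nonneg ih (sub_nonneg.2 (ha _ _))

lemma survival_antitone (ha0 : ∀ u v, 0 ≤ a u v) (ha : ∀ u v, a u v ≤ 1) (z : ℕ → W) :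
    Antitone (survival a z) :=
  antitone_nat_of_succ_le fun k =>
    mul_le_of_le_one_right (survival_nonneg ha z k) (by linarith [ha0 (z k) (z (k + 1))])

lemma measurable_survival [Finite W] {Ω : Type*} {m : MeasurableSpace Ω} (z : ℕ → Ω → W) (k : ℕ)
    (hz : ∀ i ≤ k, ∀ w, MeasurableSet {ω | z i ω = w}) :
    Measurable fun ω => survival a (fun i => z i ω) k := by
  let _ : MeasurableSpace W := ⊤
  induction k with
  | zero => exact measurable_const
  | succ k ih =>
    have hm : ∀ i ≤ k + 1, Measurable (z i) := fun i hi => measurable_to_countable' (hz i hi)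
    exact (ih fun i hi => hz i (hi.trans k.le_succ)).mul (measurable_const.sub
      ((measurable_of_countable (fun p : W × W => a p.1 p.2)).comp
        ((hm k k.le_succ).prodMk (hm (k + 1) le_rfl))))

end

/-- Under the uniform law on `[0, 1)`, an independent variable lies in `[c R, R)` with `1 - c` times
the probability of lying below `R`. -/
lemma measure_inter_Ico_mul {Ω E : Type*} [MeasurableSpace Ω] [MeasurableSpace E] {μ : Measure Ω}
    [IsProbabilityMeasure μ] {f : Ω → E} {U : Ω → ℝ} (hf : Measurable f) (hU : Measurable U)
    (hind : IndepFun f U μ) (hunif : μ.map U = volume.restrict (Set.Ico 0 1)) {A : Set E}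
    (hA : MeasurableSet A) {R : E → ℝ} (hR : Measurable R) (hR0 : ∀ e, 0 ≤ R e)
    (hR1 : ∀ e, R e ≤ 1) {c : ℝ} (hc0 : 0 ≤ c) (hc1 : c ≤ 1) :
    μ {ω | f ω ∈ A ∧ R (f ω) * c ≤ U ω ∧ U ω < R (f ω)} =
      ENNReal.ofReal (1 - c) * μ {ω | f ω ∈ A ∧ U ω < R (f ω)} := by
  have hlaw := (indepFun_iff_map_prod_eq_prod_map_map hf.aemeasurable hU.aemeasurable).1 hind
  have h1 : MeasurableSet {p : E × ℝ | p.1 ∈ A ∧ R p.1 * c ≤ p.2 ∧ p.2 < R p.1} :=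
    (measurable_fst hA).inter ((measurableSet_le ((hR.comp measurable_fst).mul_const c)
      measurable_snd).inter (measurableSet_lt measurable_snd (hR.comp measurable_fst)))
  have h2 : MeasurableSet {p : E × ℝ | p.1 ∈ A ∧ p.2 < R p.1} :=
    (measurable_fst hA).inter (measurableSet_lt measurable_snd (hR.comp measurable_fst))
  have e1 := Measure.map_apply (μ := μ) (hf.prodMk hU) h1
  have e2 := Measure.map_apply (μ := μ) (hf.prodMk hU) h2
  rw [hlaw, hunif] at e1 e2
  rw [Measure.prod_apply h1] at e1
  rw [Measure.prod_apply h2] at e2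
  refine e1.symm.trans (Eq.trans ?_ (congrArg _ e2))
  rw [← lintegral_const_mul' _ _ ENNReal.ofReal_ne_top]
  refine lintegral_congr fun e => ?_
  by_cases he : e ∈ A
  · have s1 : Prod.mk e ⁻¹' {p : E × ℝ | p.1 ∈ A ∧ R p.1 * c ≤ p.2 ∧ p.2 < R p.1} ∩
        Set.Ico 0 1 = Set.Ico (R e * c) (R e) := by
      ext y
      simp only [Set.mem_inter_iff, Set.mem_preimage, Set.mem_ofPred_eq, Set.mem_Ico, he, true_and]
      have := mul_nonneg (hR0 e) hc0
      have := hR1 e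
      constructor
      · exact fun h => h.1
      · exact fun h => ⟨h, by linarith [h.1], by linarith [h.2]⟩
    have s2 : Prod.mk e ⁻¹' {p : E × ℝ | p.1 ∈ A ∧ p.2 < R p.1} ∩ Set.Ico 0 1 =
        Set.Ico 0 (R e) := by
      ext y
      simp only [Set.mem_inter_iff, Set.mem_preimage, Set.mem_ofPred_eq, Set.mem_Ico, he, true_and]
      have := hR1 e
      constructor
      · exact fun h => ⟨h.2.1, h.1⟩
      · exact fun h => ⟨h.2, h.1, by linarith [h.2]⟩
    rw [Measure.restrict_apply (measurable_prodMk_left h1),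
      Measure.restrict_apply (measurable_prodMk_left h2), s1, s2, Real.volume_Ico,
      Real.volume_Ico, ← ENNReal.ofReal_mul (sub_nonneg.2 hc1)]
    congr 1
    ring
  · have s1 : Prod.mk e ⁻¹' {p : E × ℝ | p.1 ∈ A ∧ R p.1 * c ≤ p.2 ∧ p.2 < R p.1} = ∅ := by
      ext y
      simp [he]
    have s2 : Prod.mk e ⁻¹' {p : E × ℝ | p.1 ∈ A ∧ p.2 < R p.1} = ∅ := by
      ext y
      simp [he]
    rw [s1, s2, measure_empty, mul_zero]

variable {Ω W : Type*} [Fintype W] [MeasurableSpace W] [MeasurableSingletonClass W]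
  {m0 : MeasurableSpace Ω} {μ : Measure Ω} [IsProbabilityMeasure μ]
  {F : ℝ≥0 → MeasurableSpace Ω} {Z : ℝ≥0 → Ω → W} {K : ℝ≥0 → Matrix W W ℝ}

/-- If the transition matrix at time `r` dominates `κ` times the stationary law `p`, then a
Markov process carrying an independent uniform variable `U` has a strong stationary time of
expectation at most `r / κ`. Along the skeleton `Z 0, Z r, Z (2 r), …` a step from `u` to `v` is
declared a success with probability `κ p v / K r u v`; conditionally on the past, a success has
probability `κ` and leaves the process in state `v` with law `p`. All the trials are read off the
single variable `U`: the first `k` of them fail when `U < survival k`. -/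
lemma IsMarkovWith.exists_strongStationary (h : IsMarkovWith μ F Z K) {r : ℝ≥0} {κ : ℝ}
    (hκ : 0 < κ) {p : W → ℝ} (hp : ∀ w, 0 < p w) (hp1 : ∑ w, p w = 1)
    (hstat : ∀ t v, ∑ u, p u * K t u v = p v) (hK0 : ∀ t u v, 0 ≤ K t u v)
    (hK : ∀ u v, κ * p v ≤ K r u v) {U : Ω → ℝ} (hU : ∀ t, Measurable[F t] U)
    (hind : IndepFun (fun ω t => Z t ω) U μ)
    (hunif : μ.map U = volume.restrict (Set.Ico 0 1)) :
    ∃ S : Ω → ℝ≥0∞, (∀ t : ℝ≥0, MeasurableSet[F t] {ω | S ω ≤ t}) ∧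
      (∀ᵐ ω ∂μ, S ω ≠ ∞) ∧
      (∀ (t : ℝ≥0) (v : W), μ {ω | Z (t + (S ω).toNNReal) ω = v} = ENNReal.ofReal (p v)) ∧
      IndepFun (fun ω (t : ℝ≥0) => Z (t + (S ω).toNNReal) ω) S μ ∧
      ∫⁻ ω, S ω ∂μ ≤ r * (ENNReal.ofReal κ)⁻¹ := by
  set a : W → W → ℝ := fun u v => κ * p v / K r u v with ha
  have hKpos : ∀ u v, 0 < K r u v := fun u v => (mul_pos hκ (hp v)).trans_le (hK u v)
  have ha0 : ∀ u v, 0 ≤ a u v := fun u v =>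
    div_nonneg (mul_nonneg hκ.le (hp v).le) (hKpos u v).le
  have ha1 : ∀ u v, a u v ≤ 1 := fun u v => div_le_one_of_le₀ (hK u v) (hKpos u v).le
  set R : ℕ → Ω → ℝ := fun k ω => survival a (fun i => Z (i * r) ω) k with hRdef
  have hRanti : ∀ ω, Antitone fun k => R k ω := fun ω => survival_antitone ha0 ha1 _
  have hRm : ∀ k : ℕ, Measurable[F (k * r)] (R k) := fun k =>
    measurable_survival (m := F (k * r)) (fun i => Z (i * r)) k fun i hi w =>
      h.mono (by gcongr) _ (h.adapted _ _)
  -- `B k` is the event that the first `k` trials fail, `D k` that the first success is the trial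
  -- number `k + 1`.
  set B : ℕ → Set Ω := fun k => {ω | U ω < R k ω} with hBdef
  set D : ℕ → Set Ω := fun k => {ω | R (k + 1) ω ≤ U ω ∧ U ω < R k ω} with hDdef
  have hBF : ∀ k : ℕ, MeasurableSet[F (k * r)] (B k) := fun k =>
    @measurableSet_lt _ _ _ _ _ (F (k * r)) _ _ _ _ _ (hU _) (hRm k)
  have hDF : ∀ k : ℕ, MeasurableSet[F ((k + 1 : ℕ) * r)] (D k) := fun k => by
    have h1 : MeasurableSet[F ((k + 1 : ℕ) * r)] {ω | R (k + 1) ω ≤ U ω} :=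
      @measurableSet_le _ _ _ _ _ (F ((k + 1 : ℕ) * r)) _ _ _ _ _ (hRm (k + 1)) (hU _)
    exact h1.inter (h.mono (by gcongr; simp) _ (hBF k))
  have hBm : ∀ k, MeasurableSet (B k) := fun k => h.le _ _ (hBF k)
  have hDm : ∀ k, MeasurableSet (D k) := fun k => h.le _ _ (hDF k)
  have hDdisj : Pairwise (Function.onFun Disjoint D) := by
    have hlt : ∀ i j, i < j → Disjoint (D i) (D j) := fun i j hij =>
      Set.disjoint_left.2 fun ω hi hj =>
        absurd (hi.1.trans_lt hj.2) (not_lt.2 (hRanti ω (Nat.succ_le_of_lt hij)))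
    intro i j hij
    rcases hij.lt_or_gt with hlt' | hlt'
    · exact hlt i j hlt'
    · exact (hlt j i hlt').symm
  have hUm : Measurable U := fun s hs => h.le 0 _ (hU 0 hs)
  have hB0 : μ (B 0) = 1 := by
    have : B 0 = U ⁻¹' Set.Iio 1 := rfl
    rw [this, ← Measure.map_apply hUm measurableSet_Iio, hunif,
      Measure.restrict_apply measurableSet_Iio]
    have : Set.Iio (1 : ℝ) ∩ Set.Ico 0 1 = Set.Ico 0 1 := Set.inter_eq_right.2 fun x hx => hx.2
    rw [this, Real.volume_Ico]
    simp
  -- A trial succeeds with probability `κ`, whatever the past, and then leaves the state with law `p`.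
  have hDZ : ∀ (k : ℕ) (v : W), μ (D k ∩ {ω | Z ((k + 1 : ℕ) * r) ω = v}) =
      ENNReal.ofReal (κ * p v) * μ (B k) := fun k v => by
    rw [measure_eq_sum_inter_fiber μ (h.measurableSet_eq (k * r)),
      measure_eq_sum_inter_fiber μ (h.measurableSet_eq (k * r)) (B k), Finset.mul_sum]
    refine Finset.sum_congr rfl fun u _ => ?_
    have hpath : Measurable fun ω (t : ℝ≥0) => Z t ω := by simpa using h.measurable_path 0
    have hev : ∀ t : ℝ≥0, Measurable fun z : ℝ≥0 → W => z t := fun t => measurable_pi_apply t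
    have hI := measure_inter_Ico_mul hpath hUm hind hunif
      (A := {z | z (k * r) = u ∧ z ((k + 1 : ℕ) * r) = v})
      ((hev _ (measurableSet_singleton u)).inter (hev _ (measurableSet_singleton v)))
      (R := fun z => survival a (fun i => z (i * r)) k)
      (measurable_survival (fun (i : ℕ) (z : ℝ≥0 → W) => z (i * r)) k fun i _ w =>
        hev (i * r) (measurableSet_singleton w))
      (fun z => survival_nonneg ha1 _ _)
      (fun z => survival_antitone ha0 ha1 _ (Nat.zero_le k))
      (c := 1 - a u v) (sub_nonneg.2 (ha1 u v)) (by linarith [ha0 u v])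
    have e1 : D k ∩ {ω | Z ((k + 1 : ℕ) * r) ω = v} ∩ {ω | Z (k * r) ω = u} =
        {ω | (Z (k * r) ω = u ∧ Z ((k + 1 : ℕ) * r) ω = v) ∧
          R k ω * (1 - a u v) ≤ U ω ∧ U ω < R k ω} := by
      ext ω
      simp only [Set.mem_inter_iff, Set.mem_ofPred_eq, hDdef]
      constructor
      · rintro ⟨⟨⟨h1, h2⟩, rfl⟩, rfl⟩
        exact ⟨⟨rfl, rfl⟩, h1, h2⟩
      · rintro ⟨⟨rfl, rfl⟩, h1, h2⟩
        exact ⟨⟨⟨h1, h2⟩, rfl⟩, rfl⟩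
    have e2 : {ω | (Z (k * r) ω = u ∧ Z ((k + 1 : ℕ) * r) ω = v) ∧ U ω < R k ω} =
        (B k ∩ {ω | Z (k * r) ω = u}) ∩ {ω | Z (k * r + r) ω = v} := by
      have : ((k + 1 : ℕ) : ℝ≥0) * r = k * r + r := by
        push_cast
        ring
      ext ω
      simp only [Set.mem_inter_iff, Set.mem_ofPred_eq, hBdef, this]
      tauto
    rw [e1]
    refine hI.trans ?_
    rw [sub_sub_cancel]
    refine (congrArg _ (congrArg μ e2)).trans ?_
    rw [h.measure_inter_eq_mul ((hBF k).inter (h.adapted _ u)) fun ω hω => hω.2, mul_left_comm,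
      mul_comm, ← ENNReal.ofReal_mul (ha0 u v), div_mul_cancel₀ _ (hKpos u v).ne']
  have hDμ : ∀ k, μ (D k) = ENNReal.ofReal κ * μ (B k) := fun k => by
    rw [measure_eq_sum_inter_fiber μ (h.measurableSet_eq ((k + 1 : ℕ) * r))]
    simp_rw [hDZ, ← Finset.sum_mul]
    rw [← ENNReal.ofReal_sum_of_nonneg fun v _ => mul_nonneg hκ.le (hp v).le, ← Finset.mul_sum,
      hp1, mul_one]
  have hκ0 : ENNReal.ofReal κ ≠ 0 := (ENNReal.ofReal_pos.2 hκ).ne'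
  have hsumB : ∑' k, μ (B k) ≤ (ENNReal.ofReal κ)⁻¹ := by
    rw [ENNReal.le_inv_iff_mul_le, mul_comm, ← ENNReal.tsum_mul_left]
    simp_rw [← hDμ]
    rw [← measure_iUnion hDdisj hDm]
    exact prob_le_one
  have hfinB : ∀ᵐ ω ∂μ, ∑' k, (B k).indicator (1 : Ω → ℝ≥0∞) ω < ∞ := by
    refine ae_lt_top' (AEMeasurable.tsum fun k =>
      (measurable_one.indicator (hBm k)).aemeasurable) ?_
    rw [lintegral_tsum fun k => (measurable_one.indicator (hBm k)).aemeasurable]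
    simp only [lintegral_indicator_one (hBm _)]
    exact (hsumB.trans_lt (ENNReal.inv_lt_top.2 (ENNReal.ofReal_pos.2 hκ))).ne
  -- The expected number of failures is finite, so some trial succeeds.
  have hcover : ∀ᵐ ω ∂μ, ω ∈ ⋃ k, D k := by
    have hB0' : ∀ᵐ ω ∂μ, ω ∈ B 0 := (mem_ae_iff_prob_eq_one (hBm 0)).2 hB0
    filter_upwards [hfinB, hB0'] with ω hω h0
    by_contra hcon
    have hall : ∀ k, ω ∈ B k := fun k => by
      induction k with
      | zero => exact h0
      | succ k ih =>
        by_contra hk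
        exact hcon (Set.mem_iUnion.2 ⟨k, not_lt.1 hk, ih⟩)
    have h1 : ∀ k, (B k).indicator (1 : Ω → ℝ≥0∞) ω = 1 := fun k =>
      Set.indicator_of_mem (hall k) _
    simp only [h1, ENNReal.tsum_const_eq_top_of_ne_zero one_ne_zero] at hω
    exact lt_irrefl _ hω
  have hsplit : ∀ A : Set Ω, μ A = ∑' k, μ (A ∩ D k) := fun A => by
    have h1 : μ A = μ (A ∩ ⋃ k, D k) :=
      (measure_inter_conull' (by
        rw [measure_eq_zero_iff_ae_notMem]
        filter_upwards [hcover] with ω hω hn using hn.2 hω)).symm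
    rw [h1, ← Measure.restrict_apply' (MeasurableSet.iUnion hDm),
      Measure.restrict_iUnion hDdisj hDm, Measure.sum_apply_of_countable]
    simp only [Measure.restrict_apply' (hDm _)]
  have hDsum : ∑' k, μ (D k) = 1 := by simpa using (hsplit Set.univ).symm
  set S : Ω → ℝ≥0∞ := fun ω => ⨅ (k : ℕ) (_ : R k ω ≤ U ω), ((k * r : ℝ≥0) : ℝ≥0∞) with hS
  have hSD : ∀ k, ∀ ω ∈ D k, S ω = (((k + 1 : ℕ) * r : ℝ≥0) : ℝ≥0∞) := fun k ω hω => by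
    refine le_antisymm (iInf₂_le (k + 1) hω.1) (le_iInf₂ fun j hj => ?_)
    have hkj : k + 1 ≤ j := by
      by_contra! hlt
      exact absurd (hj.trans_lt hω.2) (not_lt.2 (hRanti ω (Nat.lt_succ_iff.1 hlt)))
    gcongr
  have hSD' : ∀ k, ∀ ω ∈ D k, (S ω).toNNReal = (k + 1 : ℕ) * r := fun k ω hω => by
    rw [hSD k ω hω, ENNReal.toNNReal_coe]
  -- The law of the process after `S` does not depend on the value of `S`.
  have hlaw : ∀ (k : ℕ) {C : Set (ℝ≥0 → W)}, MeasurableSet C →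
      μ (D k ∩ (fun ω t => Z (t + (k + 1 : ℕ) * r) ω) ⁻¹' C) =
        μ (B k) * μ (D 0 ∩ (fun ω t => Z (t + (0 + 1 : ℕ) * r) ω) ⁻¹' C) := fun k C hC => by
    have := h.measure_inter_path_eq (hDF k) (hDF 0) (α := μ (B 0)) (α' := μ (B k))
      (measure_ne_top _ _) (measure_ne_top _ _) (fun v => by rw [hDZ, hDZ]; ring) hC
    rwa [hB0, one_mul] at this
  refine ⟨S, fun t => ?_, ?_, fun t v => ?_, ?_, ?_⟩
  · have : {ω | S ω ≤ t} = ⋃ (k : ℕ) (_ : k * r ≤ t), {ω | R k ω ≤ U ω} := by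
      ext ω
      simp only [Set.mem_ofPred_eq, Set.mem_iUnion, exists_prop]
      constructor
      · intro hle
        have hex : ∃ k, R k ω ≤ U ω := by
          by_contra! hcon
          have : S ω = ∞ := by simp [S, hcon]
          rw [this] at hle
          exact absurd hle (by simp)
        classical
        refine ⟨Nat.find hex, ?_, Nat.find_spec hex⟩
        have h1 : (((Nat.find hex : ℕ) * r : ℝ≥0) : ℝ≥0∞) ≤ S ω := le_iInf₂ fun j hj => by
          have := Nat.find_min' hex hj
          gcongr
        exact ENNReal.coe_le_coe.1 (h1.trans hle)
      · rintro ⟨k, hk, hkU⟩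
        exact (iInf₂_le k hkU).trans (ENNReal.coe_le_coe.2 hk)
    rw [this]
    exact MeasurableSet.iUnion fun k => MeasurableSet.iUnion fun hk =>
      h.mono hk _ (@measurableSet_le _ _ _ _ _ (F (k * r)) _ _ _ _ _ (hRm k) (hU _))
  · filter_upwards [hcover] with ω hω
    obtain ⟨k, hk⟩ := Set.mem_iUnion.1 hω
    rw [hSD k ω hk]
    exact ENNReal.coe_ne_top
  · have hk : ∀ k, μ ({ω | Z (t + (S ω).toNNReal) ω = v} ∩ D k) =
        ENNReal.ofReal (p v) * μ (D k) := fun k => by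
      have : {ω | Z (t + (S ω).toNNReal) ω = v} ∩ D k =
          D k ∩ {ω | Z ((k + 1 : ℕ) * r + t) ω = v} := by
        ext ω
        simp only [Set.mem_inter_iff, Set.mem_ofPred_eq]
        rw [and_comm]
        refine and_congr_right fun hω => ?_
        rw [hSD' k ω hω, add_comm]
      rw [this, h.markov _ t v _ (hDF k)]
      simp_rw [hDZ]
      rw [hDμ, ← hstat t v, ENNReal.ofReal_sum_of_nonneg fun u _ =>
        mul_nonneg (hp u).le (hK0 t u v), Finset.sum_mul]
      refine Finset.sum_congr rfl fun u _ => ?_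
      rw [ENNReal.ofReal_mul hκ.le, ENNReal.ofReal_mul (hp u).le]
      ring
    rw [hsplit]
    simp_rw [hk]
    rw [ENNReal.tsum_mul_left, hDsum, mul_one]
  · rw [indepFun_iff_measure_inter_preimage_eq_mul]
    intro C T hC hT
    have hCD : ∀ k, μ ((fun ω (t : ℝ≥0) => Z (t + (S ω).toNNReal) ω) ⁻¹' C ∩ D k) =
        μ (D k) * (μ (D 0 ∩ (fun ω t => Z (t + (0 + 1 : ℕ) * r) ω) ⁻¹' C) *
          (ENNReal.ofReal κ)⁻¹) := fun k => by
      have : (fun ω (t : ℝ≥0) => Z (t + (S ω).toNNReal) ω) ⁻¹' C ∩ D k =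
          D k ∩ (fun ω t => Z (t + (k + 1 : ℕ) * r) ω) ⁻¹' C := by
        ext ω
        simp only [Set.mem_inter_iff, Set.mem_preimage]
        rw [and_comm]
        refine and_congr_right fun hω => ?_
        rw [hSD' k ω hω]
      rw [this, hlaw k hC, hDμ]
      have := ENNReal.mul_inv_cancel hκ0 ENNReal.ofReal_ne_top
      calc _ = (ENNReal.ofReal κ * (ENNReal.ofReal κ)⁻¹) * (μ (B k) *
            μ (D 0 ∩ (fun ω t => Z (t + (0 + 1 : ℕ) * r) ω) ⁻¹' C)) := by rw [this, one_mul]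
        _ = _ := by ring
    set m := μ (D 0 ∩ (fun ω t => Z (t + (0 + 1 : ℕ) * r) ω) ⁻¹' C) * (ENNReal.ofReal κ)⁻¹
    classical
    have hTD : ∀ (k : ℕ) (A : Set Ω), μ (A ∩ S ⁻¹' T ∩ D k) =
        if (((k + 1 : ℕ) * r : ℝ≥0) : ℝ≥0∞) ∈ T then μ (A ∩ D k) else 0 := fun k A => by
      split_ifs with hk
      · congr 1
        ext ω
        simp only [Set.mem_inter_iff, Set.mem_preimage]
        refine ⟨fun H => ⟨H.1.1, H.2⟩, fun H => ⟨⟨H.1, ?_⟩, H.2⟩⟩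
        rwa [hSD k ω H.2]
      · rw [measure_eq_zero_iff_ae_notMem]
        refine Eventually.of_forall fun ω H => hk ?_
        rw [← hSD k ω H.2]
        exact H.1.2
    have hC' : μ ((fun ω (t : ℝ≥0) => Z (t + (S ω).toNNReal) ω) ⁻¹' C) = m := by
      rw [hsplit]
      simp_rw [hCD]
      rw [ENNReal.tsum_mul_right, hDsum, one_mul]
    rw [hC', hsplit, hsplit (S ⁻¹' T), ← ENNReal.tsum_mul_left]
    refine tsum_congr fun k => ?_
    have := hTD k Set.univ
    simp only [Set.univ_inter] at this
    rw [hTD, this]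
    split_ifs
    · rw [hCD, mul_comm]
    · rw [mul_zero]
  · have hpt : ∀ᵐ ω ∂μ, S ω ≤ r * ∑' k, (B k).indicator (1 : Ω → ℝ≥0∞) ω := by
      filter_upwards [hcover] with ω hω
      obtain ⟨k, hk⟩ := Set.mem_iUnion.1 hω
      have h1 : ∀ i ∈ Finset.range (k + 1), (B i).indicator (1 : Ω → ℝ≥0∞) ω = 1 := fun i hi =>
        Set.indicator_of_mem (show ω ∈ B i from
          hk.2.trans_le (hRanti ω (Nat.lt_succ_iff.1 (Finset.mem_range.1 hi)))) _
      have h2 : ((k + 1 : ℕ) : ℝ≥0∞) ≤ ∑' i, (B i).indicator 1 ω := by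
        refine le_trans ?_ (ENNReal.sum_le_tsum (Finset.range (k + 1)))
        rw [Finset.sum_congr rfl h1]
        simp
      rw [hSD k ω hk, ENNReal.coe_mul, mul_comm, ENNReal.coe_natCast]
      gcongr
    calc ∫⁻ ω, S ω ∂μ ≤ ∫⁻ ω, r * ∑' k, (B k).indicator (1 : Ω → ℝ≥0∞) ω ∂μ :=
          lintegral_mono_ae hpt
      _ = r * ∑' k, μ (B k) := by
        rw [lintegral_const_mul' _ _ ENNReal.coe_ne_top,
          lintegral_tsum fun k => (measurable_one.indicator (hBm k)).aemeasurable]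
        simp only [lintegral_indicator_one (hBm _)]
      _ ≤ _ := by gcongr

end StrongStationary

/-! ### The two copies of the chain -/

lemma indepFun_comp_fst_snd {Ω₁ Ω₂ Ω₃ E : Type*} [MeasurableSpace Ω₁] [MeasurableSpace Ω₂]
    [MeasurableSpace Ω₃] [MeasurableSpace E] {μ₁ : Measure Ω₁} {μ₂ : Measure Ω₂} {μ₃ : Measure Ω₃}
    [IsProbabilityMeasure μ₁] [IsProbabilityMeasure μ₂] [IsProbabilityMeasure μ₃]
    {f : Ω₁ × Ω₂ → E} (hf : Measurable f) :
    IndepFun (fun ω : Ω₁ × Ω₂ × Ω₃ => f (ω.1, ω.2.1)) (fun ω => ω.2.2)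
      (μ₁.prod (μ₂.prod μ₃)) := by
  have h : IndepFun (fun ω : (Ω₁ × Ω₂) × Ω₃ => f ω.1) (fun ω => ω.2) ((μ₁.prod μ₂).prod μ₃) :=
    indepFun_prod hf measurable_id
  have hmp : MeasurePreserving (MeasurableEquiv.prodAssoc (α := Ω₁) (β := Ω₂) (γ := Ω₃)).symm
      (μ₁.prod (μ₂.prod μ₃)) ((μ₁.prod μ₂).prod μ₃) :=
    (measurePreserving_prodAssoc μ₁ μ₂ μ₃).symm _
  rw [indepFun_iff_measure_inter_preimage_eq_mul] at h ⊢
  intro s t hs ht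
  have hs' : MeasurableSet ((fun ω : (Ω₁ × Ω₂) × Ω₃ => f ω.1) ⁻¹' s) := (hf.comp measurable_fst) hs
  have ht' : MeasurableSet ((fun ω : (Ω₁ × Ω₂) × Ω₃ => ω.2) ⁻¹' t) := measurable_snd ht
  have h2 := h s t hs ht
  rw [← hmp.measure_preimage hs'.nullMeasurableSet, ← hmp.measure_preimage ht'.nullMeasurableSet,
    ← hmp.measure_preimage (hs'.inter ht').nullMeasurableSet] at h2
  exact h2

open scoped Kronecker in
/-- A minorization `c π ≤ p^{(r)}` yields a strong stationary time for two independent copies, of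
expectation at most `r / c ^ 2`. -/
lemma exists_isStrongStationaryTime {V Ω : Type*} [Fintype V] [DecidableEq V] [MeasurableSpace V]
    [MeasurableSingletonClass V] [MeasurableSpace Ω] {Q : Matrix V V ℝ} {π : V → ℝ}
    {P : V → Measure Ω} {X : ℝ≥0 → Ω → V} (hQ : IsGenerator Q) (hπ : IsInvariant Q π)
    (hrev : IsReversible Q π) (hpos : ∀ i, 0 < π i) (hnn : ∀ t x y, 0 ≤ transition Q t x y)
    (hX : ∀ x, IsMarkovChain Q (P x) X x) {r : ℝ≥0} {c : ℝ} (hc : 0 < c)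
    (hmin : ∀ x y, c * π y ≤ transition Q r x y) (x y : V) :
    ∃ (U : Type) (_ : MeasurableSpace U) (ν : Measure U) (_ : IsProbabilityMeasure ν)
      (S : Ω × Ω × U → ℝ≥0∞), IsStrongStationaryTime π P X x y ν S ∧
      ∫⁻ ω, S ω ∂((P x).prod ((P y).prod ν)) ≤ r * (ENNReal.ofReal (c ^ 2))⁻¹ := by
  have := (hX x).isProbabilityMeasure
  have := (hX y).isProbabilityMeasure
  set ν : Measure ℝ := volume.restrict (Set.Ico 0 1)
  have hν : IsProbabilityMeasure ν := ⟨by simp [ν]⟩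
  have h := (hX x).isMarkovWith.prod ((hX y).isMarkovWith.prod_randomness (μ₂ := ν) hnn) hnn
  have hpath : Measurable fun (ω : Ω × Ω) (t : ℝ≥0) => (X t ω.1, X t ω.2) :=
    measurable_pi_lambda _ fun t => ((hX x).isMarkovWith.measurable t |>.comp measurable_fst).prodMk
      ((hX y).isMarkovWith.measurable t |>.comp measurable_snd)
  have hU : ∀ t, Measurable[(past X t).prod ((past X t).prod inferInstance)]
      fun ω : Ω × Ω × ℝ => ω.2.2 := fun t =>
    @Measurable.comp _ _ _ _ ((past X t).prod inferInstance) _ _ _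
      (@measurable_snd _ _ (past X t) _) (@measurable_snd _ _ (past X t) _)
  obtain ⟨S, hadapt, hfin, hlaw, hind, hint⟩ := h.exists_strongStationary (r := r) (κ := c ^ 2)
    (pow_pos hc 2) (p := fun w => π w.1 * π w.2) (fun w => mul_pos (hpos _) (hpos _))
    (by simp only [Fintype.sum_prod_type, ← Finset.mul_sum, hπ.sum_eq_one, mul_one])
    (fun t v => by
      rw [← sum_invariant_mul_transition hQ hrev t v.1, ← sum_invariant_mul_transition hQ hrev t v.2,
        Finset.sum_mul_sum, Fintype.sum_prod_type]
      exact Finset.sum_congr rfl fun _ _ => Finset.sum_congr rfl fun _ _ => mul_mul_mul_comm _ _ _ _)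
    (fun t u v => mul_nonneg (hnn _ _ _) (hnn _ _ _))
    (fun u v => by
      rw [sq, mul_mul_mul_comm]
      exact mul_le_mul (hmin _ _) (hmin _ _) (mul_pos hc (hpos _)).le (hnn _ _ _))
    hU (indepFun_comp_fst_snd hpath)
    (by
      have h2 := Measure.map_map (μ := (P x).prod ((P y).prod ν)) (measurable_snd (α := Ω) (β := ℝ))
        (measurable_snd (α := Ω) (β := Ω × ℝ))
      rw [Measure.map_snd_prod, measure_univ, one_smul, Measure.map_snd_prod, measure_univ,
        one_smul] at h2
      exact h2.symm)
  exact ⟨ℝ, inferInstance, ν, hν, S, ⟨hadapt, hfin,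
    fun t i j => by simpa [Prod.ext_iff] using hlaw t (i, j), hind⟩, hint⟩

end CTChain

open CTChain in
theorem mainTheorem4 {n : ℕ} (Q : Matrix (Fin n) (Fin n) ℝ) (π : Fin n → ℝ)
    (hQ : CTChain.IsGenerator Q) (hirr : CTChain.IsIrreducible Q)
    (hπ : CTChain.IsInvariant Q π) (hrev : CTChain.IsReversible Q π)
    {Ω : Type*} [MeasurableSpace Ω] (P : Fin n → Measure Ω) (X : ℝ≥0 → Ω → Fin n)
    (hX : ∀ x, CTChain.IsMarkovChain Q (P x) X x) (s : Fin n) :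
    CTChain.expMeet P X ≤ 189 * CTChain.expHit P X s / ENNReal.ofReal (π s) ∧
    CTChain.mixingTime Q π ≤ 16 * CTChain.expHit P X s ∧
    ∀ x y : Fin n, ∃ (U : Type) (_ : MeasurableSpace U) (ν : Measure U)
      (_ : IsProbabilityMeasure ν) (S : Ω × Ω × U → ℝ≥0∞),
      CTChain.IsStrongStationaryTime π P X x y ν S ∧
      ∫⁻ ω, S ω ∂((P x).prod ((P y).prod ν)) ≤ 188 * CTChain.expHit P X s := by
  have hpos := hπ.pos hirr hrev
  have hnn : ∀ t x y, 0 ≤ transition Q t x y := fun t x y => (hX x).transition_nonneg hQ t y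
  have : Nonempty (Fin n) := ⟨s⟩
  rcases eq_or_ne (expHit P X s) ∞ with hH | hH
  · -- Only the existence of a strong stationary time has content; positivity of `p^{(1)}` gives one.
    have hπ1 : ∀ y, π y ≤ 1 := fun y =>
      hπ.sum_eq_one ▸ Finset.single_le_sum (fun i _ => hπ.nonneg i) (Finset.mem_univ y)
    obtain ⟨w, hw⟩ := Finite.exists_min fun w : Fin n × Fin n => transition Q 1 w.1 w.2
    have hw0 : 0 < transition Q 1 w.1 w.2 :=
      transition_pos hQ hirr hπ hrev hnn w.1 w.2 zero_lt_one
    refine ⟨?_, ?_, fun x y => ?_⟩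
    · rw [hH, ENNReal.mul_top (by norm_num), ENNReal.top_div_of_ne_top ENNReal.ofReal_ne_top]
      exact le_top
    · rw [hH, ENNReal.mul_top (by norm_num)]
      exact le_top
    · obtain ⟨U, mU, ν, hν, S, hS, -⟩ :=
        exists_isStrongStationaryTime hQ hπ hrev hpos hnn hX hw0
          (fun x y => (mul_le_of_le_one_right hw0.le (hπ1 y)).trans (hw (x, y))) x y
      refine ⟨U, mU, ν, hν, S, hS, ?_⟩
      rw [hH, ENNReal.mul_top (by norm_num)]
      exact le_top
  obtain ⟨H, hHs⟩ : ∃ H : ℝ≥0, expHit P X s = H := ⟨_, (ENNReal.coe_toNNReal hH).symm⟩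
  rcases eq_or_ne H 0 with rfl | h0
  · -- With a single state the minorization holds at time `0` with constant `1`.
    have := subsingleton_of_expHit_eq_zero hX hHs
    have hmin : ∀ x y, 1 * π y ≤ transition Q 0 x y := fun x y => by
      rw [Subsingleton.elim x y, transition_zero, Matrix.one_apply_eq, one_mul, ← hπ.sum_eq_one]
      exact Finset.single_le_sum (fun i _ => hπ.nonneg i) (Finset.mem_univ y)
    refine ⟨?_, ?_, fun x y => ?_⟩
    · refine (iSup₂_le fun x y => ?_).trans zero_le
      have hm : ∀ ω : Ω × Ω, meetTime (fun t (ω : Ω × Ω) => X t ω.1) (fun t ω => X t ω.2) ω ≤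
          (0 : ℝ≥0) := fun ω =>
        iInf₂_le (0 : ℝ≥0) (Subsingleton.elim (X 0 ω.1) (X 0 ω.2))
      exact (lintegral_mono hm).trans (by simp)
    · have hd : statDist Q π (0 + 0) ≤ 1 / 4 := statDist_le_of_half_le hQ hπ hrev fun x y =>
        (mul_le_mul_of_nonneg_right (by norm_num) (hpos y).le).trans (hmin x y)
      refine (mixingTime_le hd).trans ?_
      simp
    · obtain ⟨U, mU, ν, hν, S, hS, hint⟩ :=
        exists_isStrongStationaryTime hQ hπ hrev hpos hnn hX one_pos hmin x y
      exact ⟨U, mU, ν, hν, S, hS, hint.trans (by simp)⟩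
  have hH0 : 0 < H := pos_iff_ne_zero.2 h0
  obtain ⟨δ, l, hl, hlδ, hc⟩ := exists_avoid_le hX hnn hHs hH0
  have hδ : 0 < δ := pos_iff_ne_zero.2 fun h => by
    rw [h, mul_zero] at hlδ
    exact (mul_pos four_pos hH0).ne hlδ
  -- `(5 / 7) ^ 2 ≥ 1 / 2`
  have hmin : ∀ x y, 1 / 2 * π y ≤ transition Q (2 * (l * δ)) x y := fun x y =>
    (mul_le_mul_of_nonneg_right (by norm_num) (hpos y).le).trans
      (sq_mul_le_transition_of_avoid hQ hπ hrev hpos hnn (c := 5 / 7) (by norm_num) hc x y)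
  have hHr : (H : ℝ≥0∞) = ENNReal.ofReal H := ENNReal.ofReal_coe_nnreal.symm
  refine ⟨?_, ?_, fun x y => ?_⟩
  · refine (expMeet_le hQ hπ hrev hpos hnn hX hδ hl (by norm_num) hc).trans ?_
    have hs := hpos s
    have h189 : (189 : ℝ≥0∞) = ENNReal.ofReal 189 := by simp
    rw [hlδ, hHs, ← ENNReal.ofReal_coe_nnreal, hHr, h189, ← ENNReal.ofReal_mul (by norm_num),
      ← ENNReal.ofReal_inv_of_pos (by positivity), ← ENNReal.ofReal_mul (by positivity),
      ← ENNReal.ofReal_div_of_pos hs]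
    refine ENNReal.ofReal_le_ofReal ?_
    push_cast
    rw [← div_eq_mul_inv, div_le_div_iff₀ (by positivity) hs]
    have : 0 ≤ (H : ℝ) * π s := by positivity
    nlinarith
  · refine (mixingTime_le (statDist_le_of_half_le hQ hπ hrev hmin)).trans_eq ?_
    rw [hlδ, hHs]
    push_cast
    ring
  · obtain ⟨U, mU, ν, hν, S, hS, hint⟩ :=
      exists_isStrongStationaryTime hQ hπ hrev hpos hnn hX (by norm_num) hmin x y
    refine ⟨U, mU, ν, hν, S, hS, hint.trans ?_⟩
    have h188 : (188 : ℝ≥0∞) = ENNReal.ofReal 188 := by simp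
    rw [hlδ, hHs, ← ENNReal.ofReal_coe_nnreal, hHr, h188, ← ENNReal.ofReal_mul (by norm_num),
      ← ENNReal.ofReal_inv_of_pos (by positivity), ← ENNReal.ofReal_mul (by positivity)]
    refine ENNReal.ofReal_le_ofReal ?_
    push_cast
    have : (0 : ℝ) < H := hH0
    norm_num
    linarith
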